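/- **Setting.** Let $n\ge 1$, $A\in\mathbb R^{n\times n}$, $b,c\in\mathbb R^n$ with $(A,b)$ controllable, let $\Omega\subset\mathbb R^n$ be compact and convex and $\theta\in\Omega$ (the unknown parameter). Consider the plant $$\dot x(t)=Ax(t)+b\,(u(t)-\theta^\top x(t)),\quad x(0)=x_0,\qquad y(t)=c^\top x(t),\qquad t\ge 0 .$$ Let $K\in\mathbb R^n$ be such that $A_m=A-bK^\top$ is Hurwitz, $Q$ symmetric positive definite, $P$ the solution of $A_m^\top P+PA_m=-Q$, $C(s)$ a stable strictly proper rational transfer function with $C(0)=1$, $\Gamma_c>0$, $r:[0,\infty)\to\mathbb R$ bounded and continuous, $H_o(s)=(sI-A_m)^{-1}b$ and $k_g=1/(c^\top H_o(0))$. The $\mathcal L_1$ adaptive controller is $$u=-K^\top x+u_2,\qquad u_2(s)=C(s)\big(\bar r(s)+k_g r(s)\big),\quad \bar r(t)=\hat\theta(t)^\top x(t),$$ $$\dot{\hat x}=A_m\hat x-b\,\hat\theta^\top x+b\,u_2,\quad \hat x(0)=x_0,\qquad \dot{\hat\theta}=\Gamma_c\,\mathrm{Proj}\big(\hat\theta,\;x\,(\hat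 x-x)^\top Pb\big),\quad \hat\theta(0)=\hat\theta_0\in\Omega,$$ where $v(s)=C(s)w(s)$ means that $v$ is the convolution of $w$ with the impulse response of $C$, and $\mathrm{Proj}(\vartheta,\cdot)$ is the Euclidean projection onto the tangent cone of $\Omega$ at $\vartheta$ (the equation for $\hat\theta$ holds in the sense of Carathéodory). The reference system is the same plant, with state $x_{ref}$, $x_{ref}(0)=x_0$, output $y_{ref}=c^\top x_{ref}$, and control $$u_{ref}(s)=C(s)\big(k_g r(s)+\eta(s)\big)-K^\top x_{ref}(s),\qquad \eta(t)=\theta^\top x_{ref}(t).$$ **Norms and constants.** For a signal $\xi$ on $[0,\infty)$, $\|\xi\|_{\mathcal L_\infty}=\max_i\sup_{t\ge0}|\xi_i(t)|$. The $\mathcal L_1$ gain of a scalar stable proper system with impulse response $d\,\delta(t)+h(t)$ is $|d|+\int_0^\infty|h(t)|\,dt$, and $\|H(s)\|_{\mathcal L_1}=\max_i\sum_j\|H_{ij}(s)\|_{\mathcal L_1}$ for a matrix of such systems. Let $$\bar G(s)=H_o(s)(C(s)-1),\qquad H_2(s)=I+(I-\bar G(s)\theta^\top)^{-1}\big(\bar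 G(s)\theta^\top+(C(s)-1)I\big),$$ $\theta_{\max}=\max_{\vartheta\in\Omega}\sum_i|\vartheta_i|$, $\bar\theta_{\max}=\max_{\vartheta\in\Omega}\sum_i4\vartheta_i^2$, and let $\lambda_{\min}(P)$ be the smallest eigenvalue of $P$. **Theorem.** Assume $\|\bar G(s)\|_{\mathcal L_1}\theta_{\max}<1$. Then every trajectory of the closed loop with the $\mathcal L_1$ adaptive controller and of the reference system satisfies $$\|x-x_{ref}\|_{\mathcal L_\infty}\le\frac{\gamma_1}{\sqrt{\Gamma_c}},\qquad \|y-y_{ref}\|_{\mathcal L_\infty}\le\|c^\top\|_{\mathcal L_1}\frac{\gamma_1}{\sqrt{\Gamma_c}},\qquad \gamma_1=\|H_2(s)\|_{\mathcal L_1}\sqrt{\bar\theta_{\max}/\lambda_{\min}(P)}<\infty,$$ where $\|c^\top\|_{\mathcal L_1}=\sum_i|c_i|$ is the $\mathcal L_1$ gain of the constant system $c^\top$. Moreover, there is $c_o\in\mathbb R^n$ such that $c_o^\top H_o(s)=N_n(s)/N_d(s)$ with polynomials $N_n,N_d$ all of whose zeros have negative real part and $\deg N_d=\deg N_n+1$,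 and for every such $c_o$ $$\|u-u_{ref}\|_{\mathcal L_\infty}\le\frac{\gamma_2}{\sqrt{\Gamma_c}},\qquad \gamma_2=\Big\|C(s)\frac{1}{c_o^\top H_o(s)}c_o^\top\Big\|_{\mathcal L_1}\sqrt{\frac{\bar\theta_{\max}}{\lambda_{\min}(P)}}+\big\|C(s)\theta^\top-K^\top\big\|_{\mathcal L_1}\gamma_1<\infty .$$ -/

import Mathlib

open MeasureTheory Set
open scoped Matrix ENNReal

noncomputable section

namespace L1Adaptive

/-! ### Signals, transfer functions and gains -/

/-- The `L∞` norm `max_i sup_{t ≥ 0} |ξ_i(t)|` of a signal on `[0, ∞)`. -/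
def linftyNorm {ι : Type*} (ξ : ℝ → ι → ℝ) : ℝ≥0∞ :=
  ⨆ i, ⨆ t : ℝ, ⨆ _ : 0 ≤ t, ENNReal.ofReal |ξ t i|

/-- The transfer function `F(s)` is stable and proper with impulse response `d δ(t) + h(t)`:
`h` is integrable on `[0, ∞)` and `F(s) = d + ∫₀^∞ e^{-st} h(t) dt` on the closed right
half-plane. The pair `(d, h)` is determined by `F` up to changing `h` on a null set. -/
def IsImpulseResponse (F : ℂ → ℂ) (d : ℝ) (h : ℝ → ℝ) : Prop :=
  IntegrableOn h (Ici 0) ∧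
    ∀ s : ℂ, 0 ≤ s.re → F s = (d : ℂ) + ∫ t in Ici (0 : ℝ), Complex.exp (-s * t) * (h t : ℂ)

/-- The `L₁` gain `|d| + ∫₀^∞ |h(t)| dt` of a single-input single-output system with impulse
response `d δ + h`; it is `∞` when there is no such impulse response, that is, when the system is
not proper and stable. (The infimum is over one pair `(d, h)`, up to null sets.) -/
def sisoL1Gain (F : ℂ → ℂ) : ℝ≥0∞ :=
  ⨅ (d : ℝ) (h : ℝ → ℝ) (_ : IsImpulseResponse F d h),
    ENNReal.ofReal |d| + ∫⁻ t in Ici (0 : ℝ), ENNReal.ofReal |h t|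

/-- The `L₁` gain `max_i ∑_j ‖H_ij‖` of a multi-input multi-output system. -/
def l1Gain {ι κ : Type*} [Fintype κ] (H : ℂ → Matrix ι κ ℂ) : ℝ≥0∞ :=
  ⨆ i, ∑ j, sisoL1Gain (fun s => H s i j)

/-- On `[0, ∞)`, `v` is the response of the system `F(s)` to the input `w` (with zero initial
state), that is `v(s) = F(s) w(s)`: the convolution of `w` with the impulse response of `F`. -/
def IsResponse (F : ℂ → ℂ) (w v : ℝ → ℝ) : Prop :=
  ∃ (d : ℝ) (h : ℝ → ℝ), IsImpulseResponse F d h ∧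
    ∀ t, 0 ≤ t → v t = d * w t + ∫ τ in (0 : ℝ)..t, h (t - τ) * w τ

/-- A stable (Hurwitz) polynomial: all complex zeros in the open left half-plane. -/
def IsStablePoly (p : Polynomial ℝ) : Prop :=
  ∀ z : ℂ, Polynomial.aeval z p = 0 → z.re < 0

/-- A Hurwitz matrix: all complex eigenvalues in the open left half-plane. -/
def IsHurwitz {n : ℕ} (M : Matrix (Fin n) (Fin n) ℝ) : Prop :=
  ∀ z ∈ spectrum ℂ (M.map (algebraMap ℝ ℂ)), z.re < 0

/-- Controllability of `(A, b)`: the matrix `[b, A b, …, A^{n-1} b]` has full rank. -/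
def IsControllable {n : ℕ} (A : Matrix (Fin n) (Fin n) ℝ) (b : Fin n → ℝ) : Prop :=
  (Matrix.of fun i k : Fin n => ((A ^ (k : ℕ)) *ᵥ b) i).rank = n

/-- The minimum eigenvalue of a matrix with real eigenvalues. -/
def lambdaMin {n : ℕ} (P : Matrix (Fin n) (Fin n) ℝ) : ℝ := sInf (spectrum ℝ P)

/-! ### The projection operator -/

/-- The tangent cone of the convex set `Ω` at `θ`. -/
def tangentCone {n : ℕ} (Ω : Set (Fin n → ℝ)) (θ : Fin n → ℝ) : Set (Fin n → ℝ) :=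
  closure {w | ∃ a : ℝ, 0 ≤ a ∧ ∃ z ∈ Ω, w = a • (z - θ)}

/-- `v = Proj(θ, y)`: the vector `v` is the Euclidean projection of `y` onto the tangent cone of
`Ω` at `θ`. -/
def IsProj {n : ℕ} (Ω : Set (Fin n → ℝ)) (θ y v : Fin n → ℝ) : Prop :=
  v ∈ tangentCone Ω θ ∧
    ∀ w ∈ tangentCone Ω θ, ∑ i, (y i - v i) ^ 2 ≤ ∑ i, (y i - w i) ^ 2

/-! ### The plant and the controller -/

/-- The data of the plant (`A`, `b`, `c`, the unknown parameter `θ`, the set `Ω` containing it, the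
initial state `x₀`), of the controller (`K`, `Q`, `P`, the filter `C(s)`, the adaptation gain `Γ_c`,
the initial estimate `θ̂₀`), and the reference signal `r`. -/
structure Setup (n : ℕ) where
  A : Matrix (Fin n) (Fin n) ℝ
  b : Fin n → ℝ
  c : Fin n → ℝ
  θ : Fin n → ℝ
  Ω : Set (Fin n → ℝ)
  x₀ : Fin n → ℝ
  K : Fin n → ℝ
  Q : Matrix (Fin n) (Fin n) ℝ
  P : Matrix (Fin n) (Fin n) ℝ
  filter : RatFunc ℝ
  Γc : ℝ
  θhat₀ : Fin n → ℝ
  r : ℝ → ℝ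

namespace Setup

variable {n : ℕ} (S : Setup n)

/-- `A_m = A - b Kᵀ`. -/
def Am : Matrix (Fin n) (Fin n) ℝ := S.A - Matrix.vecMulVec S.b S.K

/-- The standing assumptions on the data. -/
structure Standing : Prop where
  controllable : IsControllable S.A S.b
  compact : IsCompact S.Ω
  convex : Convex ℝ S.Ω
  θ_mem : S.θ ∈ S.Ω
  hurwitz : IsHurwitz S.Am
  Q_posDef : S.Q.PosDef
  lyapunov : S.Amᵀ * S.P + S.P * S.Am = -S.Q
  filter_strictlyProper : S.filter.num.degree < S.filter.denom.degree
  filter_stable : IsStablePoly S.filter.denom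
  filter_zero : S.filter.eval (RingHom.id ℝ) 0 = 1
  Γc_pos : 0 < S.Γc
  θhat₀_mem : S.θhat₀ ∈ S.Ω
  r_continuous : ContinuousOn S.r (Ici 0)
  r_bounded : ∃ M : ℝ, ∀ t, 0 ≤ t → |S.r t| ≤ M

/-- `C(s)`. -/
def C (s : ℂ) : ℂ := S.filter.eval (algebraMap ℝ ℂ) s

/-- `H_o(s) = (s I - A_m)⁻¹ b`. -/
def Ho (s : ℂ) : Fin n → ℂ :=
  (s • (1 : Matrix (Fin n) (Fin n) ℂ) - S.Am.map (algebraMap ℝ ℂ))⁻¹ *ᵥ fun i => (S.b i : ℂ)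

/-- `k_g = 1 / (cᵀ H_o(0))`, where `H_o(0) = (-A_m)⁻¹ b` is real. (The bounds do not depend on the
value of `k_g`, so nothing is assumed about the denominator.) -/
def kg : ℝ := 1 / (S.c ⬝ᵥ ((-S.Am)⁻¹ *ᵥ S.b))

/-- `Ḡ(s) = H_o(s) (C(s) - 1)`. -/
def Gbar (s : ℂ) : Fin n → ℂ := fun i => S.Ho s i * (S.C s - 1)

/-- `Ḡ(s) θᵀ`. -/
def GbarTheta (s : ℂ) : Matrix (Fin n) (Fin n) ℂ :=
  Matrix.vecMulVec (S.Gbar s) fun i => (S.θ i : ℂ)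

/-- `H₂(s) = I + (I - Ḡ(s) θᵀ)⁻¹ (Ḡ(s) θᵀ + (C(s) - 1) I)`. -/
def H2 (s : ℂ) : Matrix (Fin n) (Fin n) ℂ :=
  1 + (1 - S.GbarTheta s)⁻¹ * (S.GbarTheta s + (S.C s - 1) • 1)

/-- `θ_max = max_{θ ∈ Ω} ∑ |θ_i|`. -/
def thetaMax : ℝ := sSup ((fun ϑ : Fin n → ℝ => ∑ i, |ϑ i|) '' S.Ω)

/-- `θ̄_max = max_{θ ∈ Ω} ∑ 4 θ_i²`. -/
def thetaBarMax : ℝ := sSup ((fun ϑ : Fin n → ℝ => ∑ i, 4 * ϑ i ^ 2) '' S.Ω)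

/-- The `L₁`-gain requirement `‖Ḡ‖ θ_max < 1`. -/
def GainCondition : Prop :=
  l1Gain (fun s => Matrix.replicateCol Unit (S.Gbar s)) * ENNReal.ofReal S.thetaMax < 1

/-- `c_oᵀ H_o(s)`. -/
def coHo (co : Fin n → ℝ) (s : ℂ) : ℂ := (fun i => (co i : ℂ)) ⬝ᵥ S.Ho s

/-- `c_oᵀ H_o(s) = N_n(s) / N_d(s)` with stable polynomials `N_n`, `N_d`, the degree of `N_d` being
one more than the degree of `N_n`. -/
def IsMinPhaseRelDegOne (co : Fin n → ℝ) : Prop :=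
  ∃ Nn Nd : Polynomial ℝ, IsStablePoly Nn ∧ IsStablePoly Nd ∧
    Nd.natDegree = Nn.natDegree + 1 ∧
    ∀ s : ℂ, 0 ≤ s.re → S.coHo co s = Polynomial.aeval s Nn / Polynomial.aeval s Nd

/-- `γ₁ = ‖H₂‖ √(θ̄_max / λ_min(P))`. -/
def γ₁ : ℝ≥0∞ := l1Gain S.H2 * ENNReal.ofReal √(S.thetaBarMax / lambdaMin S.P)

/-- `γ₂ = ‖C (1 / (c_oᵀ H_o)) c_oᵀ‖ √(θ̄_max / λ_min(P)) + ‖C θᵀ - Kᵀ‖ γ₁`. -/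
def γ₂ (co : Fin n → ℝ) : ℝ≥0∞ :=
  l1Gain (fun s => Matrix.replicateRow Unit fun i => S.C s * (1 / S.coHo co s) * (co i : ℂ)) *
      ENNReal.ofReal √(S.thetaBarMax / lambdaMin S.P) +
    l1Gain (fun s => Matrix.replicateRow Unit fun i => S.C s * (S.θ i : ℂ) - (S.K i : ℂ)) * S.γ₁

/-- The `L₁` gain of the constant system `cᵀ`. -/
def cGain : ℝ≥0∞ := l1Gain fun _ => Matrix.replicateRow Unit fun i => (S.c i : ℂ)

/-- The plant `ẋ = A x + b (u - θᵀ x)`, `x(0) = x₀`, on `[0, ∞)`. -/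
def IsPlant (x : ℝ → Fin n → ℝ) (u : ℝ → ℝ) : Prop :=
  x 0 = S.x₀ ∧ ∀ t, 0 ≤ t →
    HasDerivWithinAt x (S.A *ᵥ x t + (u t - S.θ ⬝ᵥ x t) • S.b) (Ici 0) t

/-- The closed loop of the plant with the `L₁` adaptive controller: `x` is the state, `u` the control
signal, `u₂` its adaptive part, `xhat` the state of the predictor, `θhat` the parameter estimate. -/
structure IsClosedLoop (x xhat θhat : ℝ → Fin n → ℝ) (u u₂ : ℝ → ℝ) : Prop where
  plant : S.IsPlant x u
  /-- `u = u₁ + u₂` with `u₁ = -Kᵀ x`. -/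
  control : ∀ t, 0 ≤ t → u t = -(S.K ⬝ᵥ x t) + u₂ t
  predictor_init : xhat 0 = S.x₀
  predictor : ∀ t, 0 ≤ t →
    HasDerivWithinAt xhat (S.Am *ᵥ xhat t - (θhat t ⬝ᵥ x t) • S.b + u₂ t • S.b) (Ici 0) t
  /-- `dθ̂/dt = Γ_c Proj(θ̂, x x̃ᵀ P b)`, `θ̂(0) = θ̂₀`, with `x̃ = x̂ - x`; the right-hand side is
  discontinuous in `θ̂`, so this holds in the sense of Carathéodory. -/
  adaptation : ∃ v : ℝ → Fin n → ℝ,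
    (∀ t, 0 ≤ t → IsProj S.Ω (θhat t) (((xhat t - x t) ⬝ᵥ (S.P *ᵥ S.b)) • x t) (v t)) ∧
    ∀ t, 0 ≤ t → IntervalIntegrable v volume 0 t ∧
      θhat t = S.θhat₀ + ∫ τ in (0 : ℝ)..t, S.Γc • v τ
  /-- `u₂(s) = C(s) (r̄(s) + k_g r(s))` with `r̄ = θ̂ᵀ x`. -/
  filtered : IsResponse S.C (fun t => θhat t ⬝ᵥ x t + S.kg * S.r t) u₂

/-- The closed-loop reference system: the plant with the controller
`u_ref(s) = C(s) (k_g r(s) + η(s)) - Kᵀ x_ref(s)`, `η = θᵀ x_ref`. -/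
structure IsReference (xref : ℝ → Fin n → ℝ) (uref : ℝ → ℝ) : Prop where
  plant : S.IsPlant xref uref
  control : IsResponse S.C (fun t => S.kg * S.r t + S.θ ⬝ᵥ xref t)
    (fun t => uref t + S.K ⬝ᵥ xref t)

end Setup

end L1Adaptive

end

noncomputable section

namespace L1Adaptive

section Analysis

open Filter Topology ContinuousLinearMap

/-! ### The Laplace transform on the half-line -/

/-! Write x̃ = x̂ - x, e = x - x_ref and w = (θ̂ - θ)ᵀx. The signal u₂ enters plant and predictor
alike, so x̃' = A_m x̃ - b w with x̃(0) = 0, that is x̃ = -H_o w. Along trajectories x̃ᵀPx̃ + |θ̂ -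
θ|²/Γ_c does not increase: the cross terms are controlled by the variational inequality of the
projection. As x̃(0) = 0, this gives |x̃_i| ≤ √(θ̄_max/λ_min(P))/√Γ_c for all time
(`Setup.IsClosedLoop.abs_error_le`). The rest is linear algebra over stable systems. Subtracting the
two loops removes r and leaves e = H_o((C - 1)θᵀe + C w) = Ḡ θᵀe - C x̃. Small gain makes 1 - θᵀḠ
invertible among stable proper systems; solving for θᵀe gives e = -H₂ x̃
(`Setup.Standing.tracking_error_eq`), and the L₁ gain turns the bound on x̃ into the bound on e. For
the control, u - u_ref = (Cθᵀ - Kᵀ)e + C w. The signal w itself is not estimated, but c_oᵀx̃ =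
-(c_oᵀH_o)w, hence C w = -(C/(c_oᵀH_o)) c_oᵀx̃, and C/(c_oᵀH_o) is proper and stable
(`Setup.Standing.Csys_smul_eq`). To make "multiply by a transfer function" rigorous, stable proper
transfer functions on the closed right half-plane form a commutative ring acting on all causal
signals continuous on [0, ∞), bounded or not. Uniqueness of impulse responses makes the action well
defined, and associativity of causal convolution makes it a module. Thus no a priori bound on x,
x_ref or w is needed, and identities between transfer functions are checked pointwise in s.
Existence of c_o follows because controllability makes every polynomial of degree below n a
numerator of c_oᵀH_o. -/

lemma norm_exp_neg_mul_le_one {s : ℂ} (hs : 0 ≤ s.re) {t : ℝ} (ht : 0 ≤ t) :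
    ‖Complex.exp (-s * t)‖ ≤ 1 := by
  rw [Complex.norm_exp]
  simp only [neg_mul, Complex.neg_re, Complex.mul_re, Complex.ofReal_re, Complex.ofReal_im, mul_zero,
    sub_zero, Real.exp_le_one_iff, Left.neg_nonpos_iff]
  positivity

lemma integrableOn_exp_mul {h : ℝ → ℂ} (hh : IntegrableOn h (Ici 0)) {s : ℂ} (hs : 0 ≤ s.re) :
    IntegrableOn (fun t : ℝ => Complex.exp (-s * t) * h t) (Ici 0) := by
  refine Integrable.mono hh ?_ ?_
  · exact (by fun_prop : Continuous fun t : ℝ => Complex.exp (-s * t)).aestronglyMeasurable.mul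
      hh.aestronglyMeasurable
  · filter_upwards [ae_restrict_mem measurableSet_Ici] with t ht
    rw [norm_mul]
    exact mul_le_of_le_one_left (norm_nonneg _) (norm_exp_neg_mul_le_one hs ht)

/-- Dominated convergence; the integrand tends to 0 except at t = 0, a null set. It recovers the
feedthrough d as the limit of F along the positive reals. -/
lemma tendsto_laplace_atTop {h : ℝ → ℂ} (hh : IntegrableOn h (Ici 0)) :
    Tendsto (fun x : ℝ => ∫ t in Ici (0 : ℝ), Complex.exp (-(x : ℂ) * t) * h t) atTop (𝓝 0) := by
  have := tendsto_integral_filter_of_dominated_convergence (μ := volume.restrict (Ici (0 : ℝ)))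
    (l := atTop) (F := fun (x : ℝ) (t : ℝ) => Complex.exp (-(x : ℂ) * t) * h t) (f := fun _ => 0)
    (fun t => ‖h t‖) ?_ ?_ hh.norm ?_
  · simpa using this
  · filter_upwards [eventually_ge_atTop 0] with x hx
    exact (integrableOn_exp_mul hh (s := x) (by simpa using hx)).aestronglyMeasurable
  · filter_upwards [eventually_ge_atTop 0] with x hx
    filter_upwards [ae_restrict_mem measurableSet_Ici] with t ht
    rw [norm_mul]
    exact mul_le_of_le_one_left (norm_nonneg _) (norm_exp_neg_mul_le_one (by simpa using hx) ht)
  · have h0 : ∀ᵐ t ∂(volume.restrict (Ici (0 : ℝ))), t ≠ 0 :=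
      ae_restrict_of_ae (Measure.ae_ne volume 0)
    filter_upwards [ae_restrict_mem measurableSet_Ici, h0] with t ht ht0
    have htp : 0 < t := lt_of_le_of_ne ht (Ne.symm ht0)
    rw [tendsto_zero_iff_norm_tendsto_zero]
    have : Tendsto (fun x : ℝ => Real.exp (-(x * t)) * ‖h t‖) atTop (𝓝 0) := by
      have := (Real.tendsto_exp_neg_atTop_nhds_zero.comp
        (tendsto_id.atTop_mul_const htp)).mul_const ‖h t‖
      simpa using this
    refine this.congr fun x => ?_
    rw [norm_mul, Complex.norm_exp]
    simp

/-- An integrable real function whose Fourier transform vanishes is zero almost everywhere. -/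
lemma ae_eq_zero_of_forall_integral_exp_eq_zero {μ : Measure ℝ} [SFinite μ] {k : ℝ → ℝ}
    (hk : Integrable k μ)
    (h0 : ∀ ω : ℝ, ∫ t, Complex.exp (ω * t * Complex.I) * (k t : ℂ) ∂μ = 0) : k =ᵐ[μ] 0 := by
  have hm1 : AEMeasurable (fun t => ENNReal.ofReal (k t)) μ := hk.1.aemeasurable.ennreal_ofReal
  have hm2 : AEMeasurable (fun t => ENNReal.ofReal (-k t)) μ :=
    hk.1.aemeasurable.neg.ennreal_ofReal
  have hf1 : ∫⁻ t, ENNReal.ofReal (k t) ∂μ ≠ ∞ :=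
    ((lintegral_mono fun t => ENNReal.ofReal_le_ofReal (le_abs_self (k t))).trans_lt
      (by simpa [HasFiniteIntegral, ← ofReal_norm] using hk.2)).ne
  have hf2 : ∫⁻ t, ENNReal.ofReal (-k t) ∂μ ≠ ∞ :=
    ((lintegral_mono fun t => ENNReal.ofReal_le_ofReal (neg_le_abs (k t))).trans_lt
      (by simpa [HasFiniteIntegral, ← ofReal_norm] using hk.2)).ne
  have := isFiniteMeasure_withDensity hf1
  have := isFiniteMeasure_withDensity hf2
  -- The positive and negative parts of k are densities of finite measures, and the hypothesis says
  -- that their characteristic functions agree.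
  have key : μ.withDensity (fun t => ENNReal.ofReal (k t)) =
      μ.withDensity (fun t => ENNReal.ofReal (-k t)) := by
    apply Measure.ext_of_charFun
    ext ω
    rw [charFun_apply_real, charFun_apply_real,
      integral_withDensity_eq_integral_toReal_smul₀ hm1 (by simp),
      integral_withDensity_eq_integral_toReal_smul₀ hm2 (by simp), ← sub_eq_zero]
    have hb : ∀ t : ℝ, ‖Complex.exp (ω * t * Complex.I)‖ ≤ 1 := fun t => by
      rw [← Complex.ofReal_mul, Complex.norm_exp_ofReal_mul_I]
    have hc : AEStronglyMeasurable (fun t : ℝ => Complex.exp (ω * t * Complex.I)) μ :=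
      (by fun_prop : Continuous fun t : ℝ => Complex.exp (ω * t * Complex.I)).aestronglyMeasurable
    have i1 : Integrable (fun t => (ENNReal.ofReal (k t)).toReal •
        Complex.exp (ω * t * Complex.I)) μ := by
      exact (integrable_toReal_of_lintegral_ne_top hm1 hf1).smul_bdd 1 hc (ae_of_all _ hb)
    have i2 : Integrable (fun t => (ENNReal.ofReal (-k t)).toReal •
        Complex.exp (ω * t * Complex.I)) μ := by
      exact (integrable_toReal_of_lintegral_ne_top hm2 hf2).smul_bdd 1 hc (ae_of_all _ hb)
    rw [← integral_sub i1 i2, ← h0 ω]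
    congr 1 with t
    rw [← sub_smul, mul_comm (Complex.exp _), Complex.real_smul]
    congr 2
    rw [ENNReal.toReal_ofReal', ENNReal.toReal_ofReal']
    rcases le_total 0 (k t) with h | h
    · rw [max_eq_left h, max_eq_right (by linarith)]; ring
    · rw [max_eq_right h, max_eq_left (by linarith)]; ring
  have := (withDensity_eq_iff hm1 hm2 hf1).1 key
  filter_upwards [this] with t ht
  rcases le_total 0 (k t) with h | h
  · rw [ENNReal.ofReal_of_nonpos (by linarith : -k t ≤ 0)] at ht
    exact le_antisymm (ENNReal.ofReal_eq_zero.1 ht) h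
  · rw [ENNReal.ofReal_of_nonpos h] at ht
    have := ENNReal.ofReal_eq_zero.1 ht.symm
    simp only [Pi.zero_apply]
    linarith

/-- The impulse response of a transfer function is unique up to null sets. -/
lemma IsImpulseResponse.unique {F G : ℂ → ℂ} {d d' : ℝ} {h h' : ℝ → ℝ}
    (H : IsImpulseResponse F d h) (H' : IsImpulseResponse G d' h')
    (hFG : ∀ s : ℂ, 0 ≤ s.re → F s = G s) :
    d = d' ∧ h =ᵐ[volume.restrict (Ici 0)] h' := by
  have hi : IntegrableOn (fun t => ((h t : ℂ))) (Ici 0) := H.1.ofReal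
  have hi' : IntegrableOn (fun t => ((h' t : ℂ))) (Ici 0) := H'.1.ofReal
  have hd : d = d' := by
    have l1 := (tendsto_laplace_atTop hi).const_add (d : ℂ)
    have l2 := (tendsto_laplace_atTop hi').const_add (d' : ℂ)
    have : Tendsto (fun x : ℝ => (d : ℂ) + ∫ t in Ici (0 : ℝ), Complex.exp (-(x : ℂ) * t) * h t)
        atTop (𝓝 (d' + 0)) := by
      refine l2.congr' ?_
      filter_upwards [eventually_ge_atTop 0] with x hx
      rw [← H.2 x (by simpa using hx), ← H'.2 x (by simpa using hx), hFG _ (by simpa using hx)]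
    have := tendsto_nhds_unique l1 this
    simpa using this
  refine ⟨hd, ?_⟩
  have : (fun t => h t - h' t) =ᵐ[volume.restrict (Ici 0)] 0 := by
    refine ae_eq_zero_of_forall_integral_exp_eq_zero (H.1.sub H'.1) fun ω => ?_
    -- On the imaginary axis, s = -iω turns the Laplace kernel into e^{iωt}.
    have hs : 0 ≤ (-(ω : ℂ) * Complex.I).re := by simp
    have e := H.2 _ hs
    rw [hFG _ hs, H'.2 _ hs, hd, add_right_inj] at e
    rw [← sub_eq_zero, ← integral_sub (integrableOn_exp_mul hi' hs) (integrableOn_exp_mul hi hs)] at e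
    rw [← neg_eq_zero, ← integral_neg, ← e]
    congr 1 with t
    push_cast
    rw [show -(-(ω : ℂ) * Complex.I) * t = ω * t * Complex.I by ring]
    ring
  filter_upwards [this] with t ht
  simpa [sub_eq_zero] using ht

/-! ### Convolution on the half-line -/

section Convolution

variable {𝕜 : Type*} [RCLike 𝕜]

/-- Convolution of two scalar functions on the real line. -/
abbrev conv (f g : ℝ → 𝕜) : ℝ → 𝕜 := convolution f g (ContinuousLinearMap.mul ℝ 𝕜) volume

lemma conv_apply (f g : ℝ → 𝕜) (t : ℝ) : conv f g t = ∫ τ, f τ * g (t - τ) := rfl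

lemma conv_eq_zero_of_neg {f g : ℝ → 𝕜} (hf : ∀ t < 0, f t = 0) (hg : ∀ t < 0, g t = 0)
    {t : ℝ} (ht : t < 0) : conv f g t = 0 := by
  rw [conv_apply]
  convert integral_zero ℝ 𝕜 with τ
  rcases lt_or_ge τ 0 with h | h
  · rw [hf τ h, zero_mul]
  · rw [hg _ (by linarith), mul_zero]

/-- The convolution of causal functions is an integral over `[0, t]`. -/
lemma conv_eq_intervalIntegral {f g : ℝ → 𝕜} (hg : ∀ t < 0, g t = 0) {t : ℝ} (ht : 0 ≤ t) :
    conv ((Ici 0).indicator f) g t = ∫ τ in (0 : ℝ)..t, f (t - τ) * g τ := by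
  rw [conv, convolution_eq_swap, intervalIntegral.integral_of_le ht, ← integral_Icc_eq_integral_Ioc,
    ← integral_indicator measurableSet_Icc]
  congr 1 with τ
  rw [ContinuousLinearMap.mul_apply']
  by_cases h : τ ∈ Icc 0 t
  · rw [indicator_of_mem h, indicator_of_mem (show t - τ ∈ Ici 0 by simpa using h.2)]
  · rw [indicator_of_notMem h]
    rcases lt_or_ge τ 0 with h' | h'
    · rw [hg τ h', mul_zero]
    · rw [indicator_of_notMem, zero_mul]
      simp only [mem_Icc, not_and, not_le, mem_Ici, sub_nonneg] at h ⊢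
      exact h h'

lemma indicator_Ici_of_neg (f : ℝ → 𝕜) : ∀ t < 0, (Ici (0 : ℝ)).indicator f t = 0 :=
  fun t ht => indicator_of_notMem (by simpa using ht) f

end Convolution

/-- The complex-valued analogue of `IsImpulseResponse`. -/
def IsComplexImpulseResponse (F : ℂ → ℂ) (d : ℂ) (h : ℝ → ℂ) : Prop :=
  IntegrableOn h (Ici 0) ∧
    ∀ s : ℂ, 0 ≤ s.re → F s = d + ∫ t in Ici (0 : ℝ), Complex.exp (-s * t) * h t

lemma isImpulseResponse_iff_complex {F : ℂ → ℂ} {d : ℝ} {h : ℝ → ℝ} :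
    IsImpulseResponse F d h ↔ IsComplexImpulseResponse F d (fun t => (h t : ℂ)) := by
  refine and_congr_left' ⟨fun H => H.ofReal, fun H => ?_⟩
  simpa [IntegrableOn] using H.re

lemma integrableOn_conv {f g : ℝ → ℂ} (hf : IntegrableOn f (Ici 0)) (hg : IntegrableOn g (Ici 0)) :
    IntegrableOn (conv ((Ici 0).indicator f) ((Ici 0).indicator g)) (Ici 0) :=
  (Integrable.integrable_convolution (ContinuousLinearMap.mul ℝ ℂ)
    ((integrable_indicator_iff measurableSet_Ici).2 hf)
    ((integrable_indicator_iff measurableSet_Ici).2 hg)).integrableOn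

/-- The Laplace transform of a convolution is the product of the Laplace transforms. -/
lemma laplace_conv {f g : ℝ → ℂ} (hf : IntegrableOn f (Ici 0)) (hg : IntegrableOn g (Ici 0))
    {s : ℂ} (hs : 0 ≤ s.re) :
    ∫ t in Ici (0 : ℝ), Complex.exp (-s * t) *
        conv ((Ici 0).indicator f) ((Ici 0).indicator g) t =
      (∫ t in Ici (0 : ℝ), Complex.exp (-s * t) * f t) *
        ∫ t in Ici (0 : ℝ), Complex.exp (-s * t) * g t := by
  -- Multiplication by e^{-st} distributes over convolution, so it suffices to integrate the
  -- convolution of the two weighted functions.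
  have hF := (integrable_indicator_iff measurableSet_Ici).2 (integrableOn_exp_mul hf hs)
  have hG := (integrable_indicator_iff measurableSet_Ici).2 (integrableOn_exp_mul hg hs)
  have key := integral_convolution (ContinuousLinearMap.mul ℝ ℂ) hF hG
  rw [integral_indicator measurableSet_Ici, integral_indicator measurableSet_Ici] at key
  rw [ContinuousLinearMap.mul_apply'] at key
  rw [← key, setIntegral_eq_integral_of_forall_compl_eq_zero]
  · congr 1 with t
    rw [← conv, conv_apply, conv_apply, ← integral_const_mul]
    congr 1 with τ
    by_cases h1 : τ ∈ Ici (0 : ℝ)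
    · by_cases h2 : t - τ ∈ Ici (0 : ℝ)
      · rw [indicator_of_mem h1, indicator_of_mem h1, indicator_of_mem h2, indicator_of_mem h2]
        rw [show -s * (t : ℂ) = -s * τ + -s * ((t - τ : ℝ) : ℂ) by push_cast; ring, Complex.exp_add]
        ring
      · rw [indicator_of_notMem h2, indicator_of_notMem h2]; ring
    · rw [indicator_of_notMem h1, indicator_of_notMem h1]; ring
  · intro t ht
    rw [conv_eq_zero_of_neg (indicator_Ici_of_neg _) (indicator_Ici_of_neg _) (by simpa using ht),
      mul_zero]

/-- The kernel is read off by expanding (dδ + h) ∗ (d'δ + h'). -/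
lemma IsComplexImpulseResponse.mul {F G : ℂ → ℂ} {d d' : ℂ} {h h' : ℝ → ℂ}
    (H : IsComplexImpulseResponse F d h) (H' : IsComplexImpulseResponse G d' h') :
    IsComplexImpulseResponse (fun s => F s * G s) (d * d') (fun t => d * h' t + d' * h t +
      conv ((Ici 0).indicator h) ((Ici 0).indicator h') t) := by
  have hc := integrableOn_conv H.1 H'.1
  refine ⟨((H'.1.const_mul d).add (H.1.const_mul d')).add hc, fun s hs => ?_⟩
  have i1 := (integrableOn_exp_mul H.1 hs).const_mul d'
  have i2 := (integrableOn_exp_mul H'.1 hs).const_mul d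
  have i3 := integrableOn_exp_mul hc hs
  have i4 : IntegrableOn (fun t : ℝ => d * (Complex.exp (-s * t) * h' t) +
      d' * (Complex.exp (-s * t) * h t)) (Ici 0) := i2.add i1
  have : ∀ t : ℝ, Complex.exp (-s * t) * (d * h' t + d' * h t +
      conv ((Ici 0).indicator h) ((Ici 0).indicator h') t) =
      d * (Complex.exp (-s * t) * h' t) + d' * (Complex.exp (-s * t) * h t) +
      Complex.exp (-s * t) * conv ((Ici 0).indicator h) ((Ici 0).indicator h') t :=
    fun t => by ring
  simp_rw [this]
  rw [integral_add i4 i3, integral_add i2 i1, integral_const_mul, integral_const_mul,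
    laplace_conv H.1 H'.1 hs, H.2 s hs, H'.2 s hs]
  ring

lemma IsComplexImpulseResponse.add {F G : ℂ → ℂ} {d d' : ℂ} {h h' : ℝ → ℂ}
    (H : IsComplexImpulseResponse F d h) (H' : IsComplexImpulseResponse G d' h') :
    IsComplexImpulseResponse (fun s => F s + G s) (d + d') (fun t => h t + h' t) := by
  refine ⟨H.1.add H'.1, fun s hs => ?_⟩
  simp_rw [mul_add]
  rw [integral_add (integrableOn_exp_mul H.1 hs) (integrableOn_exp_mul H'.1 hs), H.2 s hs, H'.2 s hs]
  ring

lemma isComplexImpulseResponse_const (a : ℂ) :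
    IsComplexImpulseResponse (fun _ => a) a (fun _ => 0) :=
  ⟨integrableOn_zero, fun s _ => by simp⟩

lemma IsComplexImpulseResponse.congr {F G : ℂ → ℂ} {d : ℂ} {h : ℝ → ℂ}
    (H : IsComplexImpulseResponse F d h) (hFG : ∀ s : ℂ, 0 ≤ s.re → G s = F s) :
    IsComplexImpulseResponse G d h :=
  ⟨H.1, fun s hs => (hFG s hs).trans (H.2 s hs)⟩

/-- The impulse response of `1 / (s - z)` is `e^{zt}`. -/
lemma isComplexImpulseResponse_inv_sub {z : ℂ} (hz : z.re < 0) :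
    IsComplexImpulseResponse (fun s => (s - z)⁻¹) 0 (fun t => Complex.exp (z * t)) := by
  refine ⟨?_, fun s hs => ?_⟩
  · rw [integrableOn_Ici_iff_integrableOn_Ioi]
    exact integrableOn_exp_mul_complex_Ioi hz 0
  · have h1 : (z - s).re < 0 := by simp; linarith
    have h2 := integral_exp_mul_complex_Ioi h1 0
    rw [integral_Ici_eq_integral_Ioi, zero_add]
    simp_rw [← Complex.exp_add]
    simp_rw [show ∀ t : ℝ, -s * (t : ℂ) + z * t = (z - s) * t from fun t => by ring]
    rw [h2]
    simp only [Complex.ofReal_zero, mul_zero, Complex.exp_zero]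
    rw [neg_div, one_div, ← inv_neg, neg_sub]

lemma IsImpulseResponse.mul {F G : ℂ → ℂ} {d d' : ℝ} {h h' : ℝ → ℝ}
    (H : IsImpulseResponse F d h) (H' : IsImpulseResponse G d' h') :
    IsImpulseResponse (fun s => F s * G s) (d * d') (fun t => d * h' t + d' * h t +
      conv ((Ici 0).indicator h) ((Ici 0).indicator h') t) := by
  rw [isImpulseResponse_iff_complex] at *
  convert H.mul H' using 2 with t
  · push_cast; rfl
  · push_cast
    congr 1
    rw [conv_apply, conv_apply, ← integral_complex_ofReal]
    congr 1 with τ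
    by_cases h1 : τ ∈ Ici (0 : ℝ) <;> by_cases h2 : t - τ ∈ Ici (0 : ℝ) <;> simp [indicator, h1, h2]

lemma IsImpulseResponse.add {F G : ℂ → ℂ} {d d' : ℝ} {h h' : ℝ → ℝ}
    (H : IsImpulseResponse F d h) (H' : IsImpulseResponse G d' h') :
    IsImpulseResponse (fun s => F s + G s) (d + d') (fun t => h t + h' t) := by
  rw [isImpulseResponse_iff_complex] at *
  convert H.add H' using 2 <;> push_cast <;> rfl

lemma isImpulseResponse_const (a : ℝ) : IsImpulseResponse (fun _ => (a : ℂ)) a (fun _ => 0) :=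
  ⟨integrableOn_zero, fun s _ => by simp⟩

lemma IsImpulseResponse.congr {F G : ℂ → ℂ} {d : ℝ} {h : ℝ → ℝ}
    (H : IsImpulseResponse F d h) (hFG : ∀ s : ℂ, 0 ≤ s.re → G s = F s) :
    IsImpulseResponse G d h :=
  ⟨H.1, fun s hs => (hFG s hs).trans (H.2 s hs)⟩

/-! ### Stable systems acting on causal signals -/

/-- A causal kernel sees w only up to time t, so a bound on the past suffices; the signals of the
loop are not known to be globally bounded. -/
lemma convolutionExistsAt_of_causal {f w : ℝ → ℝ} (hf : Integrable f) (hf0 : ∀ t < 0, f t = 0)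
    (hw : AEStronglyMeasurable w) {t M : ℝ} (hM : ∀ τ ≤ t, |w τ| ≤ M) :
    ConvolutionExistsAt f w t (ContinuousLinearMap.mul ℝ ℝ) volume := by
  refine Integrable.mono' (hf.norm.mul_const M)
    (hf.1.convolution_integrand_snd (ContinuousLinearMap.mul ℝ ℝ) hw t) (ae_of_all _ fun τ => ?_)
  rw [ContinuousLinearMap.mul_apply', norm_mul]
  rcases lt_or_ge τ 0 with h | h
  · simp [hf0 τ h]
  · exact mul_le_mul_of_nonneg_left (hM _ (by linarith)) (norm_nonneg _)

lemma conv_congr_right {f w w' : ℝ → ℝ} (hf0 : ∀ t < 0, f t = 0) {t : ℝ}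
    (h : ∀ τ ≤ t, w τ = w' τ) : conv f w t = conv f w' t := by
  rw [conv_apply, conv_apply]
  congr 1 with τ
  rcases lt_or_ge τ 0 with hτ | hτ
  · simp [hf0 τ hτ]
  · rw [h _ (by linarith)]

/-- Convolution with causal integrable kernels is associative on causal, locally bounded signals. -/
lemma conv_assoc {f g w : ℝ → ℝ} (hf : Integrable f) (hf0 : ∀ t < 0, f t = 0)
    (hg : Integrable g) (hg0 : ∀ t < 0, g t = 0) (hw : AEStronglyMeasurable w)
    (hw0 : ∀ t < 0, w t = 0) {t M : ℝ} (hM : ∀ τ ≤ t, |w τ| ≤ M) :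
    conv (conv f g) w t = conv f (conv g w) t := by
  -- By causality, cutting w off after time t changes nothing at t, and the truncated signal is
  -- integrable and bounded, as the general associativity theorem requires.
  set w' : ℝ → ℝ := (Iic t).indicator w with hw'
  have hw't : ∀ τ ≤ t, w τ = w' τ := fun τ hτ => (indicator_of_mem (show τ ∈ Iic t from hτ) w).symm
  have hw'm : AEStronglyMeasurable w' := hw.indicator measurableSet_Iic
  have hM' : ∀ τ, |w' τ| ≤ max M 0 := fun τ => by
    by_cases h : τ ∈ Iic t
    · rw [hw', indicator_of_mem h]; exact (hM τ h).trans (le_max_left _ _)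
    · rw [hw', indicator_of_notMem h]; simp
  have hw'i : Integrable w' := by
    have hb : Integrable ((Icc 0 t).indicator fun _ : ℝ => max M 0) :=
      (integrable_indicator_iff measurableSet_Icc).2 (integrableOn_const (by simp))
    refine hb.mono' hw'm (ae_of_all _ fun τ => ?_)
    by_cases h : τ ∈ Icc 0 t
    · rw [indicator_of_mem h]; exact hM' τ
    · rw [indicator_of_notMem h, hw']
      by_cases h' : τ ∈ Iic t
      · have : τ < 0 := by
          by_contra hc
          exact h ⟨not_lt.1 hc, h'⟩
        rw [indicator_of_mem h', hw0 τ this]; simp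
      · rw [indicator_of_notMem h']; simp
  rw [conv_congr_right (fun τ hτ => conv_eq_zero_of_neg hf0 hg0 hτ) hw't,
    conv_congr_right (w := conv g w) (w' := conv g w') hf0
      fun τ hτ => conv_congr_right hg0 fun σ hσ => hw't σ (hσ.trans hτ)]
  have hgn0 : ∀ t < 0, ‖g t‖ = 0 := fun t ht => by simp [hg0 t ht]
  refine convolution_assoc (ContinuousLinearMap.mul ℝ ℝ) (ContinuousLinearMap.mul ℝ ℝ)
    (ContinuousLinearMap.mul ℝ ℝ) (ContinuousLinearMap.mul ℝ ℝ) ?_ hf.1 hg.1 hw'm ?_ ?_ ?_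
  · intro x y z; simp [mul_assoc]
  · exact hf.ae_convolution_exists (ContinuousLinearMap.mul ℝ ℝ) hg
  · exact ae_of_all _ fun x => convolutionExistsAt_of_causal hg.norm hgn0 hw'm.norm
      (M := max M 0) fun τ _ => by simpa using hM' τ
  · refine convolutionExistsAt_of_causal hf.norm (fun t ht => by simp [hf0 t ht])
      (Integrable.integrable_convolution (ContinuousLinearMap.mul ℝ ℝ) hg.norm hw'i.norm).1
      (M := ∫ σ, ‖g σ‖ * max M 0) fun τ _ => ?_
    rw [← Real.norm_eq_abs]
    refine norm_integral_le_of_norm_le (hg.norm.mul_const _) (ae_of_all _ fun σ => ?_)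
    simp only [ContinuousLinearMap.mul_apply', norm_mul, norm_norm]
    exact mul_le_mul_of_nonneg_left (hM' _) (norm_nonneg _)

/-- Causal signals that are continuous on `[0, ∞)`. -/
def causalSignals : Submodule ℝ (ℝ → ℝ) where
  carrier := {w | ContinuousOn w (Ici 0) ∧ ∀ t < 0, w t = 0}
  add_mem' := fun {a b} ha hb => ⟨ha.1.add hb.1, fun t ht => by simp [ha.2 t ht, hb.2 t ht]⟩
  zero_mem' := ⟨continuousOn_const, fun _ _ => rfl⟩
  smul_mem' := fun c a ha => ⟨ha.1.const_smul c, fun t ht => by simp [ha.2 t ht]⟩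

/-- The type of causal signals that are continuous on `[0, ∞)`. -/
abbrev Sig : Type := causalSignals

namespace Sig

lemma exists_bound (w : Sig) (T : ℝ) : ∃ M : ℝ, ∀ t ≤ T, |w.1 t| ≤ M := by
  obtain ⟨M, hM⟩ := (isCompact_Icc (a := (0 : ℝ)) (b := T)).exists_bound_of_continuousOn
    (w.2.1.mono Icc_subset_Ici_self)
  refine ⟨max M 0, fun t ht => ?_⟩
  rcases lt_or_ge t 0 with h | h
  · simp [w.2.2 t h]
  · exact (hM t ⟨h, ht⟩).trans (le_max_left _ _)

lemma aestronglyMeasurable (w : Sig) : AEStronglyMeasurable w.1 := by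
  have : w.1 = (Ici 0).indicator w.1 := by
    ext t
    by_cases h : t ∈ Ici (0 : ℝ)
    · rw [indicator_of_mem h]
    · rw [indicator_of_notMem h, w.2.2 t (by simpa using h)]
  rw [this, aestronglyMeasurable_indicator_iff measurableSet_Ici]
  exact w.2.1.aestronglyMeasurable measurableSet_Ici

lemma convolutionExistsAt (w : Sig) {f : ℝ → ℝ} (hf : Integrable f) (hf0 : ∀ t < 0, f t = 0)
    (t : ℝ) : ConvolutionExistsAt f w.1 t (ContinuousLinearMap.mul ℝ ℝ) volume := by
  obtain ⟨M, hM⟩ := w.exists_bound t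
  exact convolutionExistsAt_of_causal hf hf0 w.aestronglyMeasurable hM

/-- Dominated convergence: w may jump at 0, but for given t₀ this affects the integrand only at τ =
t₀, a null set. -/
lemma continuous_conv (w : Sig) {f : ℝ → ℝ} (hf : Integrable f) (hf0 : ∀ t < 0, f t = 0) :
    Continuous (conv f w.1) := by
  rw [continuous_iff_continuousAt]
  intro t₀
  obtain ⟨M, hM⟩ := w.exists_bound (t₀ + 1)
  refine continuousAt_of_dominated (bound := fun τ => ‖f τ‖ * M) ?_ ?_ (hf.norm.mul_const M) ?_
  · exact Eventually.of_forall fun t => (w.convolutionExistsAt hf hf0 t).1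
  · filter_upwards [Iic_mem_nhds (show t₀ < t₀ + 1 by linarith)] with t ht
    refine ae_of_all _ fun τ => ?_
    rw [ContinuousLinearMap.mul_apply', norm_mul]
    rcases lt_or_ge τ 0 with h | h
    · simp [hf0 τ h]
    · exact mul_le_mul_of_nonneg_left (hM _ (by linarith [mem_Iic.1 ht])) (norm_nonneg _)
  · filter_upwards [Measure.ae_ne volume t₀] with τ hτ
    simp only [ContinuousLinearMap.mul_apply']
    refine continuousAt_const.mul ?_
    have hc : ContinuousAt w.1 (t₀ - τ) := by
      rcases lt_or_gt_of_ne hτ with h | h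
      · exact w.2.1.continuousAt (Ici_mem_nhds (by linarith))
      · have : w.1 =ᶠ[𝓝 (t₀ - τ)] fun _ => 0 := by
          filter_upwards [Iio_mem_nhds (show t₀ - τ < 0 by linarith)] with σ hσ
          exact w.2.2 σ hσ
        exact continuousAt_const.congr this.symm
    exact ContinuousAt.comp (f := fun t => t - τ) (x := t₀) hc (by fun_prop)

/-- The response `d w + h ∗ w` of the system with impulse response `d δ + h`. -/
def respond (d : ℝ) (h : ℝ → ℝ) (hh : IntegrableOn h (Ici 0)) (w : Sig) : Sig :=
  ⟨fun t => d * w.1 t + conv ((Ici 0).indicator h) w.1 t,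
    ⟨(w.2.1.const_mul d).add (w.continuous_conv
      ((integrable_indicator_iff measurableSet_Ici).2 hh) (indicator_Ici_of_neg h)).continuousOn,
    fun t ht => by
      simp only [w.2.2 t ht]
      rw [conv_eq_zero_of_neg (indicator_Ici_of_neg h) w.2.2 ht, mul_zero, add_zero]⟩⟩

end Sig

/-- The closed right half-plane. -/
abbrev RHP := {s : ℂ // 0 ≤ s.re}

/-- The ring of stable proper transfer functions on the closed right half-plane. -/
def stableSubring : Subring (RHP → ℂ) where
  carrier := {F | ∃ G : ℂ → ℂ, (∀ s : RHP, F s = G s) ∧ ∃ d h, IsImpulseResponse G d h}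
  mul_mem' := by
    rintro F F' ⟨G, hG, d, h, H⟩ ⟨G', hG', d', h', H'⟩
    exact ⟨_, fun s => by simp only [Pi.mul_apply, hG, hG'], _, _, H.mul H'⟩
  add_mem' := by
    rintro F F' ⟨G, hG, d, h, H⟩ ⟨G', hG', d', h', H'⟩
    exact ⟨_, fun s => by simp only [Pi.add_apply, hG, hG'], _, _, H.add H'⟩
  one_mem' := ⟨_, fun s => by simp, _, _, isImpulseResponse_const 1⟩
  zero_mem' := ⟨_, fun s => by simp, _, _, isImpulseResponse_const 0⟩
  neg_mem' := by
    rintro F ⟨G, hG, d, h, H⟩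
    exact ⟨_, fun s => by simp [hG], _, _, (isImpulseResponse_const (-1)).mul H⟩

/-- The type of stable proper systems. -/
abbrev StableSys : Type := stableSubring

namespace StableSys

/-- The stable system with a given transfer function. -/
def mk (G : ℂ → ℂ) (hG : ∃ d h, IsImpulseResponse G d h) : StableSys :=
  ⟨fun s => G s, G, fun _ => rfl, hG⟩

/-- The constant system. -/
def const (a : ℝ) : StableSys := mk (fun _ => (a : ℂ)) ⟨_, _, isImpulseResponse_const a⟩

@[simp] lemma const_apply (a : ℝ) (s : RHP) : (const a).1 s = a := rfl

/-- The transfer function of a stable system, with an arbitrary continuation. -/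
def tf (F : StableSys) : ℂ → ℂ := F.2.choose

lemma tf_apply (F : StableSys) (s : RHP) : F.tf s = F.1 s := (F.2.choose_spec.1 s).symm

lemma exists_isImpulseResponse (F : StableSys) : ∃ d h, IsImpulseResponse F.tf d h :=
  F.2.choose_spec.2

/-- The direct feedthrough. -/
def feed (F : StableSys) : ℝ := F.exists_isImpulseResponse.choose

/-- The kernel of the impulse response. -/
def ker (F : StableSys) : ℝ → ℝ := F.exists_isImpulseResponse.choose_spec.choose

lemma isImpulseResponse (F : StableSys) : IsImpulseResponse F.tf F.feed F.ker :=
  F.exists_isImpulseResponse.choose_spec.choose_spec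

/-- The impulse response is a choice, but by `IsImpulseResponse.unique` the action does not depend
on it. -/
instance : SMul StableSys Sig := ⟨fun F w => Sig.respond F.feed F.ker F.isImpulseResponse.1 w⟩

/-- The response may be computed from any impulse response. -/
lemma smul_eq_respond {F : StableSys} {G : ℂ → ℂ} {d : ℝ} {h : ℝ → ℝ}
    (H : IsImpulseResponse G d h) (hFG : ∀ s : RHP, F.1 s = G s) (w : Sig) :
    F • w = Sig.respond d h H.1 w := by
  obtain ⟨hd, hh⟩ := F.isImpulseResponse.unique H fun s hs => by
    rw [← hFG ⟨s, hs⟩, F.tf_apply ⟨s, hs⟩]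
  refine Subtype.ext (funext fun t => ?_)
  change F.feed * w.1 t + conv ((Ici 0).indicator F.ker) w.1 t =
    d * w.1 t + conv ((Ici 0).indicator h) w.1 t
  have : (Ici 0).indicator F.ker =ᵐ[volume] (Ici 0).indicator h :=
    (ae_eq_restrict_iff_indicator_ae_eq measurableSet_Ici).1 hh
  rw [hd, conv, conv, convolution_congr (ContinuousLinearMap.mul ℝ ℝ) this (ae_eq_refl w.1)]

lemma smul_apply {F : StableSys} {G : ℂ → ℂ} {d : ℝ} {h : ℝ → ℝ}
    (H : IsImpulseResponse G d h) (hFG : ∀ s : RHP, F.1 s = G s) (w : Sig) (t : ℝ) :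
    (F • w).1 t = d * w.1 t + conv ((Ici 0).indicator h) w.1 t := by
  rw [smul_eq_respond H hFG]; rfl

lemma smul_apply' (F : StableSys) (w : Sig) (t : ℝ) :
    (F • w).1 t = F.feed * w.1 t + conv ((Ici 0).indicator F.ker) w.1 t := rfl

lemma integrable_ker (F : StableSys) : Integrable ((Ici 0).indicator F.ker) :=
  (integrable_indicator_iff measurableSet_Ici).2 F.isImpulseResponse.1

lemma const_smul_apply (a : ℝ) (w : Sig) (t : ℝ) : (const a • w).1 t = a * w.1 t := by
  rw [smul_apply (isImpulseResponse_const a) (fun s => rfl), conv_apply]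
  simp

lemma conv_add_right (F : StableSys) (w w' : Sig) (t : ℝ) :
    conv ((Ici 0).indicator F.ker) (w + w').1 t =
      conv ((Ici 0).indicator F.ker) w.1 t + conv ((Ici 0).indicator F.ker) w'.1 t := by
  have := ConvolutionExistsAt.distrib_add
    (w.convolutionExistsAt F.integrable_ker (indicator_Ici_of_neg _) t)
    (w'.convolutionExistsAt F.integrable_ker (indicator_Ici_of_neg _) t)
  exact this

lemma conv_add_left {f g : ℝ → ℝ} (hf : Integrable f) (hf0 : ∀ t < 0, f t = 0)
    (hg : Integrable g) (hg0 : ∀ t < 0, g t = 0) (w : Sig) (t : ℝ) :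
    conv (fun τ => f τ + g τ) w.1 t = conv f w.1 t + conv g w.1 t :=
  ConvolutionExistsAt.add_distrib (w.convolutionExistsAt hf hf0 t)
    (w.convolutionExistsAt hg hg0 t)

lemma conv_const_mul_left (a : ℝ) (f w : ℝ → ℝ) (t : ℝ) :
    conv (fun τ => a * f τ) w t = a * conv f w t := by
  simp_rw [conv_apply, ← integral_const_mul, mul_assoc]

lemma conv_const_mul_right (a : ℝ) (f w : ℝ → ℝ) (t : ℝ) :
    conv f (fun τ => a * w τ) t = a * conv f w t := by
  simp_rw [conv_apply, ← integral_const_mul]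
  congr 1 with τ
  ring

/-- This is block-diagram algebra: series connection is multiplication in the ring, by `conv_assoc`.
Loop equations can then be solved as linear equations over a commutative ring. -/
instance : Module StableSys Sig where
  one_smul w := by
    refine Subtype.ext (funext fun t => ?_)
    have : (1 : StableSys) = const 1 := Subtype.ext (funext fun s => by simp)
    rw [this, const_smul_apply, one_mul]
  mul_smul F F' w := by
    refine Subtype.ext (funext fun t => ?_)
    set h := (Ici 0).indicator F.ker with hh
    set h' := (Ici 0).indicator F'.ker with hh'
    have h0 : ∀ t < 0, h t = 0 := indicator_Ici_of_neg F.ker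
    have h0' : ∀ t < 0, h' t = 0 := indicator_Ici_of_neg F'.ker
    have hi : Integrable h := F.integrable_ker
    have hi' : Integrable h' := F'.integrable_ker
    have hc := Integrable.integrable_convolution (ContinuousLinearMap.mul ℝ ℝ) hi hi'
    have hc0 : ∀ t < 0, conv h h' t = 0 := fun t ht => conv_eq_zero_of_neg h0 h0' ht
    rw [smul_apply (F.isImpulseResponse.mul F'.isImpulseResponse)
      (fun s => by rw [F.tf_apply, F'.tf_apply]; rfl)]
    have e1 : (Ici 0).indicator (fun t => F.feed * F'.ker t + F'.feed * F.ker t + conv h h' t) =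
        fun t => (F.feed * h' t + F'.feed * h t) + conv h h' t := by
      ext t
      by_cases ht : t ∈ Ici (0 : ℝ)
      · simp only [hh, hh', indicator_of_mem ht]
      · rw [indicator_of_notMem ht, h0 t (by simpa using ht), h0' t (by simpa using ht),
          hc0 t (by simpa using ht)]
        simp
    rw [e1, conv_add_left (f := fun t => F.feed * h' t + F'.feed * h t)
        ((hi'.const_mul _).add (hi.const_mul _))
        (fun t ht => by simp [h0 t ht, h0' t ht]) hc hc0,
      conv_add_left (hi'.const_mul _) (fun t ht => by simp [h0' t ht])
        (hi.const_mul _) (fun t ht => by simp [h0 t ht]), conv_const_mul_left, conv_const_mul_left]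
    obtain ⟨M, hM⟩ := w.exists_bound t
    rw [conv_assoc hi h0 hi' h0' w.aestronglyMeasurable w.2.2 hM]
    rw [smul_apply', smul_apply']
    have e2 : (F' • w).1 = fun t => F'.feed * w.1 t + conv h' w.1 t := rfl
    rw [e2]
    have e3 := (Sig.convolutionExistsAt (F'.feed • w) hi h0 t).distrib_add
      (Sig.convolutionExistsAt (⟨conv h' w.1, (w.continuous_conv hi' h0').continuousOn,
        fun t ht => conv_eq_zero_of_neg h0' w.2.2 ht⟩ : Sig) hi h0 t)
    have e4 : conv h (fun t => F'.feed * w.1 t + conv h' w.1 t) t =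
      conv h (fun t => F'.feed * w.1 t) t + conv h (conv h' w.1) t := e3
    rw [← hh, e4, conv_const_mul_right]
    ring
  smul_zero F := by
    refine Subtype.ext (funext fun t => ?_)
    rw [smul_apply', conv_apply]
    simp
  smul_add F w w' := by
    refine Subtype.ext (funext fun t => ?_)
    change _ = (F • w).1 t + (F • w').1 t
    rw [smul_apply', smul_apply', smul_apply', conv_add_right]
    change F.feed * (w.1 t + w'.1 t) + _ = _
    ring
  add_smul F F' w := by
    refine Subtype.ext (funext fun t => ?_)
    change _ = (F • w).1 t + (F' • w).1 t
    rw [smul_apply (F.isImpulseResponse.add F'.isImpulseResponse)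
      (fun s => by rw [F.tf_apply, F'.tf_apply]; rfl), smul_apply', smul_apply']
    have : (Ici 0).indicator (fun t => F.ker t + F'.ker t) =
      fun t => (Ici 0).indicator F.ker t + (Ici 0).indicator F'.ker t := indicator_add _ _ _
    rw [this, conv_add_left F.integrable_ker (indicator_Ici_of_neg _) F'.integrable_ker
      (indicator_Ici_of_neg _)]
    ring
  zero_smul w := by
    refine Subtype.ext (funext fun t => ?_)
    have : (0 : StableSys) = const 0 := Subtype.ext (funext fun s => by simp)
    rw [this, const_smul_apply, zero_mul]
    rfl

end StableSys

protected lemma StableSys.sub_smul (F G : StableSys) (w : Sig) : (F - G) • w = F • w - G • w :=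
  sub_smul F G w

/-! ### Gains and responses -/

/-- By uniqueness the infimum runs over a single value. -/
lemma IsImpulseResponse.sisoL1Gain_eq {G : ℂ → ℂ} {d : ℝ} {h : ℝ → ℝ}
    (H : IsImpulseResponse G d h) :
    sisoL1Gain G = ENNReal.ofReal |d| + ∫⁻ t in Ici (0 : ℝ), ENNReal.ofReal |h t| := by
  refine le_antisymm (iInf_le_of_le d (iInf_le_of_le h (iInf_le _ H))) ?_
  refine le_iInf fun d' => le_iInf fun h' => le_iInf fun H' => ?_
  obtain ⟨rfl, hh⟩ := H.unique H' fun _ _ => rfl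
  gcongr 1
  exact (lintegral_congr_ae (by filter_upwards [hh] with t ht; rw [ht])).le

lemma IsImpulseResponse.sisoL1Gain_eq_ofReal {G : ℂ → ℂ} {d : ℝ} {h : ℝ → ℝ}
    (H : IsImpulseResponse G d h) :
    sisoL1Gain G = ENNReal.ofReal (|d| + ∫ t in Ici (0 : ℝ), |h t|) := by
  have hn : 0 ≤ ∫ t in Ici (0 : ℝ), |h t| := integral_nonneg fun t => abs_nonneg _
  rw [H.sisoL1Gain_eq, ENNReal.ofReal_add (abs_nonneg _) hn,
    ofReal_integral_eq_lintegral_ofReal H.1.abs (ae_of_all _ fun t => abs_nonneg _)]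

lemma sisoL1Gain_lt_top {G : ℂ → ℂ} (hG : ∃ d h, IsImpulseResponse G d h) : sisoL1Gain G < ∞ := by
  obtain ⟨d, h, H⟩ := hG
  rw [H.sisoL1Gain_eq_ofReal]
  exact ENNReal.ofReal_lt_top

/-- The `L₁` gain bounds the transfer function on the closed right half-plane. -/
lemma norm_le_sisoL1Gain {G : ℂ → ℂ} (hG : ∃ d h, IsImpulseResponse G d h) {s : ℂ}
    (hs : 0 ≤ s.re) : ENNReal.ofReal ‖G s‖ ≤ sisoL1Gain G := by
  obtain ⟨d, h, H⟩ := hG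
  rw [H.sisoL1Gain_eq_ofReal, H.2 s hs]
  refine ENNReal.ofReal_le_ofReal ((norm_add_le _ _).trans (add_le_add (by simp) ?_))
  refine norm_integral_le_of_norm_le H.1.abs ?_
  filter_upwards [ae_restrict_mem measurableSet_Ici] with t ht
  rw [norm_mul]
  refine (mul_le_of_le_one_left (norm_nonneg _) (norm_exp_neg_mul_le_one hs ht)).trans (by simp)

lemma abs_smul_le {F : StableSys} {G : ℂ → ℂ} {d : ℝ} {h : ℝ → ℝ} (H : IsImpulseResponse G d h)
    (hFG : ∀ s : RHP, F.1 s = G s) (w : Sig) {M : ℝ} (hM : ∀ t, 0 ≤ t → |w.1 t| ≤ M) (t : ℝ) :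
    |(F • w).1 t| ≤ (|d| + ∫ t in Ici (0 : ℝ), |h t|) * M := by
  have hM0 : 0 ≤ M := (abs_nonneg _).trans (hM 0 le_rfl)
  have hM' : ∀ t, |w.1 t| ≤ M := fun t => by
    rcases lt_or_ge t 0 with ht | ht
    · rw [w.2.2 t ht]; simpa
    · exact hM t ht
  rw [StableSys.smul_apply H hFG, add_mul]
  refine (abs_add_le _ _).trans (add_le_add ?_ ?_)
  · rw [abs_mul]
    exact mul_le_mul_of_nonneg_left (hM' t) (abs_nonneg _)
  · rw [conv_apply, ← Real.norm_eq_abs, ← integral_indicator measurableSet_Ici,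
      ← integral_mul_const]
    refine norm_integral_le_of_norm_le
      (((integrable_indicator_iff measurableSet_Ici).2 H.1.abs).mul_const M) (ae_of_all _ fun τ => ?_)
    rw [norm_mul]
    by_cases hτ : τ ∈ Ici (0 : ℝ)
    · rw [indicator_of_mem hτ, indicator_of_mem hτ]
      exact mul_le_mul_of_nonneg_left (hM' _) (abs_nonneg _)
    · rw [indicator_of_notMem hτ, indicator_of_notMem hτ]; simp

/-- The response to a signal bounded by `M` is bounded by the `L₁` gain times `M`. -/
lemma ofReal_abs_smul_le {F : StableSys} {G : ℂ → ℂ} (hFG : ∀ s : RHP, F.1 s = G s)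
    (w : Sig) {M : ℝ} (hM : ∀ t, 0 ≤ t → |w.1 t| ≤ M) (t : ℝ) :
    ENNReal.ofReal |(F • w).1 t| ≤ sisoL1Gain G * ENNReal.ofReal M := by
  have H : IsImpulseResponse G F.feed F.ker := F.isImpulseResponse.congr fun s hs => by
    rw [← hFG ⟨s, hs⟩, ← F.tf_apply]
  rw [H.sisoL1Gain_eq_ofReal, ← ENNReal.ofReal_mul (by positivity)]
  exact ENNReal.ofReal_le_ofReal (abs_smul_le H hFG w hM t)

/-- The signal that agrees with a given function on `[0, ∞)`. -/
def Sig.of (f : ℝ → ℝ) (hf : ContinuousOn f (Ici 0)) : Sig :=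
  ⟨(Ici 0).indicator f, hf.congr fun _ ht => indicator_of_mem ht f, indicator_Ici_of_neg f⟩

lemma Sig.of_apply {f : ℝ → ℝ} (hf : ContinuousOn f (Ici 0)) {t : ℝ} (ht : 0 ≤ t) :
    (Sig.of f hf).1 t = f t := indicator_of_mem (show t ∈ Ici 0 from ht) f

lemma Sig.ext_nonneg {v w : Sig} (h : ∀ t, 0 ≤ t → v.1 t = w.1 t) : v = w := by
  refine Subtype.ext (funext fun t => ?_)
  rcases lt_or_ge t 0 with ht | ht
  · rw [v.2.2 t ht, w.2.2 t ht]
  · exact h t ht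

@[simp] lemma Sig.add_apply (v w : Sig) (t : ℝ) : (v + w).1 t = v.1 t + w.1 t := rfl

@[simp] lemma Sig.sub_apply (v w : Sig) (t : ℝ) : (v - w).1 t = v.1 t - w.1 t := rfl

@[simp] lemma Sig.neg_apply (v : Sig) (t : ℝ) : (-v).1 t = -v.1 t := rfl

lemma Sig.sum_apply {ι : Type*} (s : Finset ι) (v : ι → Sig) (t : ℝ) :
    (∑ i ∈ s, v i).1 t = ∑ i ∈ s, (v i).1 t := by
  rw [AddSubmonoidClass.coe_finsetSum, Finset.sum_apply]

/-- Passage from convolution over [0, t] with some impulse response to the module action, through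
causality and uniqueness. -/
lemma IsResponse.eq_smul {G : ℂ → ℂ} {w v : ℝ → ℝ} (H : IsResponse G w v) {F : StableSys}
    (hFG : ∀ s : RHP, F.1 s = G s) {w' : Sig} (hw : ∀ t, 0 ≤ t → w'.1 t = w t) {t : ℝ}
    (ht : 0 ≤ t) : v t = (F • w').1 t := by
  obtain ⟨d, h, H, hv⟩ := H
  rw [StableSys.smul_apply H hFG, conv_eq_intervalIntegral w'.2.2 ht, hv t ht, hw t ht]
  congr 1
  refine intervalIntegral.integral_congr fun τ hτ => ?_
  rw [uIcc_of_le ht] at hτ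
  simp only [hw τ hτ.1]

/-! ### Rational transfer functions -/

-- Induction on the degree of q: split off a root z, q = (s - z)q₂, and write p/q = c + ((p -
-- cq)/q₂) · 1/(s - z). Sums and products of impulse responses do the rest, so no partial fractions
-- with multiplicities are needed.
open Polynomial in
lemma exists_isComplexImpulseResponse_div (n : ℕ) : ∀ p q : ℂ[X], q.natDegree = n → q ≠ 0 →
    (∀ z, q.IsRoot z → z.re < 0) → p.natDegree ≤ n →
    ∃ d h, IsComplexImpulseResponse (fun s => p.eval s / q.eval s) d h := by
  induction n with
  | zero =>
    intro p q hq _ _ hp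
    rw [eq_C_of_natDegree_eq_zero hq, eq_C_of_natDegree_le_zero hp]
    simp only [eval_C]
    exact ⟨_, _, isComplexImpulseResponse_const _⟩
  | succ n ih =>
    intro p q hq hq0 hr hp
    have hdeg : q.degree ≠ 0 := by
      rw [degree_eq_natDegree hq0, hq]
      exact_mod_cast Nat.succ_ne_zero n
    obtain ⟨z, hz⟩ := IsAlgClosed.exists_root q hdeg
    obtain ⟨q₂, rfl⟩ := dvd_iff_isRoot.2 hz
    have hq₂ : q₂ ≠ 0 := right_ne_zero_of_mul hq0
    have hq₂d : q₂.natDegree = n := by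
      rw [natDegree_mul (X_sub_C_ne_zero z) hq₂, natDegree_X_sub_C] at hq
      omega
    set q := (X - C z) * q₂ with hqdef
    -- This c cancels the coefficient of degree n + 1, which keeps (p - cq)/q₂ proper.
    set c := p.coeff (n + 1) / q.leadingCoeff with hc
    have hp' : (p - C c * q).natDegree ≤ n := by
      rw [natDegree_le_iff_coeff_eq_zero]
      intro N hN
      rw [coeff_sub, coeff_C_mul]
      rcases (Nat.succ_le_of_lt hN).eq_or_lt with h | h
      · have : q.coeff N = q.leadingCoeff := by rw [leadingCoeff, hq, ← h]
        have h0 : q.leadingCoeff ≠ 0 := leadingCoeff_ne_zero.2 hq0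
        rw [this, hc, ← h, div_mul_cancel₀ _ h0, sub_self]
      · rw [coeff_eq_zero_of_natDegree_lt (by omega), coeff_eq_zero_of_natDegree_lt (by omega)]
        simp
    obtain ⟨d, h, H⟩ := ih _ q₂ hq₂d hq₂ (fun w hw => hr w (by
      rw [IsRoot.def, hqdef, eval_mul, hw.eq_zero, mul_zero])) hp'
    refine ⟨_, _, ((isComplexImpulseResponse_const c).add
      (H.mul (isComplexImpulseResponse_inv_sub (hr z hz)))).congr fun s hs => ?_⟩
    have hqs : q.eval s ≠ 0 := fun h => absurd (hr s h) (not_lt.2 hs)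
    have hqs' : (s - z) * q₂.eval s ≠ 0 := by simpa [hqdef] using hqs
    have h1 := left_ne_zero_of_mul hqs'
    have h2 := right_ne_zero_of_mul hqs'
    simp only [hqdef, eval_sub, eval_mul, eval_C, eval_X]
    field_simp
    ring

lemma IsStablePoly.ne_zero {q : Polynomial ℝ} (hq : IsStablePoly q) : q ≠ 0 := by
  rintro rfl
  simpa using hq 0 (by simp)

lemma IsStablePoly.aeval_ne_zero {q : Polynomial ℝ} (hq : IsStablePoly q) {s : ℂ}
    (hs : 0 ≤ s.re) : Polynomial.aeval s q ≠ 0 :=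
  fun h => absurd (hq s h) (not_lt.2 hs)

lemma IsStablePoly.mul {p q : Polynomial ℝ} (hp : IsStablePoly p) (hq : IsStablePoly q) :
    IsStablePoly (p * q) := fun z hz => by
  rw [map_mul, mul_eq_zero] at hz
  exact hz.elim (hp z) (hq z)

/-- Conjugate symmetry of F makes the conjugate pair represent F too; averaging the two
representations leaves the real parts. -/
lemma IsComplexImpulseResponse.re {F : ℂ → ℂ} {d : ℂ} {h : ℝ → ℂ}
    (H : IsComplexImpulseResponse F d h)
    (hF : ∀ s : ℂ, F ((starRingEnd ℂ) s) = (starRingEnd ℂ) (F s)) :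
    IsImpulseResponse F d.re (fun t => (h t).re) := by
  refine ⟨H.1.re, fun s hs => ?_⟩
  have hs' : 0 ≤ ((starRingEnd ℂ) s).re := by simpa using hs
  have e1 := H.2 s hs
  have e2 : F s = (starRingEnd ℂ) d +
      ∫ t in Ici (0 : ℝ), Complex.exp (-s * t) * (starRingEnd ℂ) (h t) := by
    rw [← Complex.conj_conj (F s), ← hF, H.2 _ hs', map_add, ← integral_conj]
    congr 2 with t
    rw [map_mul, ← Complex.exp_conj]
    simp
  have hconj : IntegrableOn (fun t => (starRingEnd ℂ) (h t)) (Ici 0) := by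
    refine Integrable.mono H.1 (Complex.continuous_conj.comp_aestronglyMeasurable H.1.1) ?_
    exact ae_of_all _ fun t => by simp
  have e3 : (2 : ℂ) * (d.re + ∫ t in Ici (0 : ℝ), Complex.exp (-s * t) * ((h t).re : ℂ)) =
      2 * F s := by
    rw [two_mul (F s)]
    nth_rewrite 1 [e1]
    rw [e2, add_add_add_comm, ← integral_add (integrableOn_exp_mul H.1 hs)
      (integrableOn_exp_mul hconj hs), Complex.add_conj, mul_add, ← integral_const_mul]
    push_cast
    congr 2 with t
    rw [← mul_add, Complex.add_conj]
    push_cast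
    ring
  exact (mul_left_cancel₀ two_ne_zero e3).symm

/-- A proper rational function with a stable denominator has an impulse response. -/
lemma exists_isImpulseResponse_div {p q : Polynomial ℝ} (hq : IsStablePoly q)
    (hpq : p.natDegree ≤ q.natDegree) :
    ∃ d h, IsImpulseResponse (fun s => Polynomial.aeval s p / Polynomial.aeval s q) d h := by
  obtain ⟨d, h, H⟩ := exists_isComplexImpulseResponse_div (q.map (algebraMap ℝ ℂ)).natDegree
    (p.map (algebraMap ℝ ℂ)) (q.map (algebraMap ℝ ℂ)) rfl
    (by simpa [Polynomial.map_eq_zero] using hq.ne_zero)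
    (fun z hz => hq z (by rwa [Polynomial.IsRoot.def, Polynomial.eval_map_algebraMap] at hz))
    (by simpa using hpq)
  simp only [Polynomial.eval_map_algebraMap] at H
  refine ⟨_, _, H.re fun s => ?_⟩
  rw [map_div₀, Polynomial.aeval_conj, Polynomial.aeval_conj]

/-! ### Differential equations -/

lemma isImpulseResponse_lag :
    IsImpulseResponse (fun s => (s + 1)⁻¹) 0 (fun t => Real.exp (-t)) := by
  rw [isImpulseResponse_iff_complex]
  have := isComplexImpulseResponse_inv_sub (z := -1) (by simp)
  simpa using this

/-- The first-order lag `1 / (s + 1)`. -/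
def lag : StableSys := StableSys.mk (fun s => (s + 1)⁻¹) ⟨_, _, isImpulseResponse_lag⟩

/-- z' = g is (s + 1)z = z + g. Differentiation is not a stable proper system, so the equation is
divided by s + 1; the proof is the integrating factor e^τ. -/
lemma eq_lag_smul {z g : Sig} (hz0 : z.1 0 = 0)
    (hz : ∀ t, 0 ≤ t → HasDerivWithinAt z.1 (g.1 t) (Ici 0) t) : z = lag • (z + g) := by
  refine Sig.ext_nonneg fun t ht => ?_
  rw [StableSys.smul_apply isImpulseResponse_lag (fun _ => rfl),
    conv_eq_intervalIntegral (z + g).2.2 ht, zero_mul, zero_add]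
  have hc : ∀ w : Sig, ContinuousOn w.1 (uIcc 0 t) := fun w =>
    w.2.1.mono (by rw [uIcc_of_le ht]; exact Icc_subset_Ici_self)
  have key := intervalIntegral.integral_eq_sub_of_hasDeriv_right_of_le
    (f := fun τ => Real.exp (-(t - τ)) * z.1 τ)
    (f' := fun τ => Real.exp (-(t - τ)) * (z + g).1 τ) ht ?_ ?_ ?_
  · rw [key]; simp [hz0]
  · rw [← uIcc_of_le ht]
    exact (by fun_prop : Continuous fun τ => Real.exp (-(t - τ))).continuousOn.mul (hc z)
  · intro τ hτ
    have h1 : HasDerivAt (fun τ => Real.exp (-(t - τ))) (Real.exp (-(t - τ))) τ := by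
      have := (((hasDerivAt_id τ).const_sub t).neg).exp
      simpa using this
    have h2 := h1.hasDerivWithinAt.mul ((hz τ hτ.1.le).mono (Ioi_subset_Ici hτ.1.le))
    refine h2.congr_deriv ?_
    simp only [Sig.add_apply]
    ring
  · exact ((by fun_prop : Continuous fun τ => Real.exp (-(t - τ))).continuousOn.mul
      (hc (z + g))).intervalIntegrable

/-! ### Linear systems with a Hurwitz matrix -/

section Resolvent

variable {n : ℕ} (A : Matrix (Fin n) (Fin n) ℝ)

-- A cofactor is, up to sign, a determinant of size n - 1 whose entries have degree at most 1. The
-- strict inequality is what leaves room for a factor s + 1 over the characteristic polynomial.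
open Polynomial in
lemma natDegree_adjugate_charmatrix_lt (i j : Fin n) : (A.charmatrix.adjugate i j).natDegree < n := by
  cases n with
  | zero => exact i.elim0
  | succ m =>
    rw [Matrix.adjugate_fin_succ_eq_det_submatrix, Nat.lt_succ_iff]
    have h1 : A.charmatrix.submatrix j.succAbove i.succAbove =
        (X : ℝ[X]) • ((1 : Matrix (Fin (m + 1)) (Fin (m + 1)) ℝ).submatrix j.succAbove
          i.succAbove).map C + ((-A).submatrix j.succAbove i.succAbove).map C := by
      ext1 k l
      simp only [Matrix.submatrix_apply, Matrix.charmatrix_apply, Matrix.add_apply, Matrix.smul_apply,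
        Matrix.map_apply, Matrix.diagonal_apply, Matrix.one_apply, Matrix.neg_apply, smul_eq_mul]
      split_ifs <;> simp [sub_eq_add_neg]
    have h2 := natDegree_det_X_add_C_le
      ((1 : Matrix (Fin (m + 1)) (Fin (m + 1)) ℝ).submatrix j.succAbove i.succAbove)
      ((-A).submatrix j.succAbove i.succAbove)
    rw [← h1, Fintype.card_fin] at h2
    refine natDegree_mul_le.trans ?_
    have h3 : ((-1 : ℝ[X]) ^ (j + i : ℕ)).natDegree = 0 := by
      rcases neg_one_pow_eq_or ℝ[X] (j + i : ℕ) with h | h <;> rw [h] <;> simp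
    rw [h3, zero_add]
    exact h2

/-- The resolvent `(s I - A)⁻¹`. -/
def resolventMatrix (s : ℂ) : Matrix (Fin n) (Fin n) ℂ :=
  (s • (1 : Matrix (Fin n) (Fin n) ℂ) - A.map (algebraMap ℝ ℂ))⁻¹

lemma charmatrix_map_aeval (s : ℂ) :
    A.charmatrix.map (Polynomial.aeval s : Polynomial ℝ →ₐ[ℝ] ℂ) =
      s • (1 : Matrix (Fin n) (Fin n) ℂ) - A.map (algebraMap ℝ ℂ) := by
  ext i j
  simp only [Matrix.map_apply, Matrix.charmatrix_apply, Matrix.diagonal_apply, Matrix.sub_apply,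
    Matrix.smul_apply, Matrix.one_apply, map_sub, Polynomial.aeval_C, smul_eq_mul]
  split_ifs <;> simp

lemma det_smul_one_sub (s : ℂ) :
    (s • (1 : Matrix (Fin n) (Fin n) ℂ) - A.map (algebraMap ℝ ℂ)).det =
      Polynomial.aeval s A.charpoly := by
  rw [← charmatrix_map_aeval, Matrix.charpoly, AlgHom.map_det]
  rfl

lemma resolventMatrix_apply (s : ℂ) (i j : Fin n) :
    resolventMatrix A s i j =
      Polynomial.aeval s (A.charmatrix.adjugate i j) / Polynomial.aeval s A.charpoly := by
  rw [resolventMatrix, Matrix.inv_def, det_smul_one_sub, Ring.inverse_eq_inv', Matrix.smul_apply,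
    ← charmatrix_map_aeval, smul_eq_mul, div_eq_inv_mul]
  congr 1
  have := AlgHom.map_adjugate (Polynomial.aeval s : Polynomial ℝ →ₐ[ℝ] ℂ) A.charmatrix
  exact (congrFun (congrFun this i) j).symm

variable {A}

lemma IsHurwitz.isStablePoly_charpoly (hA : IsHurwitz A) : IsStablePoly A.charpoly := by
  intro z hz
  refine hA z ?_
  rw [Matrix.mem_spectrum_iff_isRoot_charpoly]
  have : (A.map (algebraMap ℝ ℂ)).charpoly = A.charpoly.map (algebraMap ℝ ℂ) :=
    Matrix.charpoly_map A (algebraMap ℝ ℂ)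
  rw [this, Polynomial.IsRoot.def, Polynomial.eval_map_algebraMap, hz]

lemma IsHurwitz.resolventMatrix_mul (hA : IsHurwitz A) {s : ℂ} (hs : 0 ≤ s.re) :
    resolventMatrix A s * (s • (1 : Matrix (Fin n) (Fin n) ℂ) - A.map (algebraMap ℝ ℂ)) = 1 := by
  refine Matrix.nonsing_inv_mul _ ?_
  rw [det_smul_one_sub, isUnit_iff_ne_zero]
  exact hA.isStablePoly_charpoly.aeval_ne_zero hs

lemma IsHurwitz.exists_isImpulseResponse_resolvent (hA : IsHurwitz A) (i j : Fin n) :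
    ∃ d h, IsImpulseResponse (fun s => resolventMatrix A s i j) d h := by
  obtain ⟨d, h, H⟩ := exists_isImpulseResponse_div (p := A.charmatrix.adjugate i j)
    hA.isStablePoly_charpoly
    (by rw [Matrix.charpoly_natDegree_eq_dim, Fintype.card_fin]
        exact (natDegree_adjugate_charmatrix_lt A i j).le)
  exact ⟨d, h, H.congr fun s _ => resolventMatrix_apply A s i j⟩

lemma IsHurwitz.exists_isImpulseResponse_lead_resolvent (hA : IsHurwitz A) (i j : Fin n) :
    ∃ d h, IsImpulseResponse (fun s => (s + 1) * resolventMatrix A s i j) d h := by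
  obtain ⟨d, h, H⟩ := exists_isImpulseResponse_div
    (p := (Polynomial.X + Polynomial.C 1) * A.charmatrix.adjugate i j) hA.isStablePoly_charpoly
    (by rw [Matrix.charpoly_natDegree_eq_dim, Fintype.card_fin]
        refine Polynomial.natDegree_mul_le.trans ?_
        rw [Polynomial.natDegree_X_add_C]
        have := natDegree_adjugate_charmatrix_lt A i j
        omega)
  refine ⟨d, h, H.congr fun s _ => ?_⟩
  rw [resolventMatrix_apply, map_mul, mul_div_assoc]
  simp

/-- The entries of `(s I - A)⁻¹` as stable systems. -/
def IsHurwitz.resolvent (hA : IsHurwitz A) (i j : Fin n) : StableSys :=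
  StableSys.mk _ (hA.exists_isImpulseResponse_resolvent i j)

/-- The solution of `z' = A z + f`, `z(0) = 0` is the response of `(s I - A)⁻¹` to `f`. -/
lemma IsHurwitz.eq_sum_resolvent_smul (hA : IsHurwitz A) {z f : Fin n → Sig}
    (hz0 : ∀ i, (z i).1 0 = 0)
    (hz : ∀ i t, 0 ≤ t →
      HasDerivWithinAt (z i).1 (∑ j, A i j * (z j).1 t + (f i).1 t) (Ici 0) t) (i : Fin n) :
    z i = ∑ j, hA.resolvent i j • f j := by
  have h1 : ∀ i, z i = lag • (z i + (∑ j, StableSys.const (A i j) • z j + f i)) := fun i =>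
    eq_lag_smul (hz0 i) fun t ht => by
      have : (∑ j, StableSys.const (A i j) • z j + f i).1 t =
          ∑ j, A i j * (z j).1 t + (f i).1 t := by
        rw [Sig.add_apply, Sig.sum_apply]
        simp only [StableSys.const_smul_apply]
      rw [this]
      exact hz i t ht
  -- D is (sI - A)/(s + 1) and E is (s + 1)(sI - A)⁻¹. Both are stable and proper, unlike sI - A
  -- itself, and E D = I.
  let D : Fin n → Fin n → StableSys := fun j k =>
    (if j = k then 1 - lag else 0) - lag * StableSys.const (A j k)
  let E : Fin n → Fin n → StableSys := fun i j =>
    StableSys.mk _ (hA.exists_isImpulseResponse_lead_resolvent i j)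
  have h2 : ∀ j, ∑ k, D j k • z k = lag • f j := fun j => by
    have : ∀ k, D j k • z k = (if j = k then (1 - lag) • z k else 0) -
        lag • StableSys.const (A j k) • z k := fun k => by
      simp only [D]
      rw [StableSys.sub_smul, mul_smul]
      split_ifs <;> simp
    simp_rw [this]
    rw [Finset.sum_sub_distrib, Finset.sum_ite_eq Finset.univ j, if_pos (Finset.mem_univ _),
      StableSys.sub_smul, one_smul, ← Finset.smul_sum]
    nth_rewrite 1 [h1 j]
    rw [smul_add, smul_add]
    abel
  have hs1 : ∀ s : RHP, (s : ℂ) + 1 ≠ 0 := fun s h => by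
    have := congrArg Complex.re h
    simp only [Complex.add_re, Complex.one_re, Complex.zero_re] at this
    linarith [s.2]
  have h3 : ∀ k, ∑ j, E i j * D j k = if i = k then 1 else 0 := fun k => by
    refine Subtype.ext (funext fun s => ?_)
    have hr := congrFun (congrFun (hA.resolventMatrix_mul s.2) i) k
    rw [Matrix.mul_apply] at hr
    have e1 : (∑ j, E i j * D j k).1 s = ∑ j, (E i j).1 s * (D j k).1 s := by
      rw [AddSubmonoidClass.coe_finsetSum, Finset.sum_apply]
      rfl
    have e2 : ∀ j, (E i j).1 s * (D j k).1 s = resolventMatrix A s i j *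
        ((s : ℂ) • (1 : Matrix (Fin n) (Fin n) ℂ) - A.map (algebraMap ℝ ℂ)) j k := fun j => by
      have : (D j k).1 s = (if j = k then 1 - ((s : ℂ) + 1)⁻¹ else 0) -
          ((s : ℂ) + 1)⁻¹ * (A j k : ℂ) := by
        simp only [D]
        split_ifs <;> rfl
      rw [this, Matrix.sub_apply, Matrix.smul_apply, Matrix.one_apply, Matrix.map_apply]
      change ((s : ℂ) + 1) * resolventMatrix A s i j * _ = _
      have := hs1 s
      split_ifs
      · simp only [smul_eq_mul, Complex.coe_algebraMap]
        field_simp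
        ring
      · simp only [smul_eq_mul, Complex.coe_algebraMap]
        field_simp
        ring
    rw [e1, Finset.sum_congr rfl fun j _ => e2 j, hr, Matrix.one_apply]
    split_ifs <;> rfl
  have h4 : ∀ j, E i j * lag = hA.resolvent i j := fun j => by
    refine Subtype.ext (funext fun s => ?_)
    change ((s : ℂ) + 1) * resolventMatrix A s i j * ((s : ℂ) + 1)⁻¹ = resolventMatrix A s i j
    have := hs1 s
    field_simp
  calc z i = ∑ k, (if i = k then (1 : StableSys) else 0) • z k := by simp
    _ = ∑ k, ∑ j, E i j • D j k • z k := by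
        refine Finset.sum_congr rfl fun k _ => ?_
        rw [← h3 k, Finset.sum_smul]
        simp only [mul_smul]
    _ = ∑ j, E i j • lag • f j := by
        rw [Finset.sum_comm]
        refine Finset.sum_congr rfl fun j _ => ?_
        rw [← Finset.smul_sum, h2]
    _ = _ := by simp only [← mul_smul, h4]

/-- Solutions of `z' = A z` with `A` Hurwitz are bounded. -/
lemma IsHurwitz.exists_bound (hA : IsHurwitz A) {z : ℝ → Fin n → ℝ}
    (hz : ∀ t, 0 ≤ t → HasDerivWithinAt z (A *ᵥ z t) (Ici 0) t) :
    ∃ M : ℝ, ∀ t, 0 ≤ t → ∀ i, |z t i| ≤ M := by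
  have hzi : ∀ i t, 0 ≤ t → HasDerivWithinAt (fun t => z t i) ((A *ᵥ z t) i) (Ici 0) t :=
    fun i t ht => hasDerivWithinAt_pi.1 (hz t ht) i
  -- Subtracting e^{-t}z(0) gives zero initial state; the difference is driven by the bounded input
  -- e^{-t}(A z(0) + z(0)).
  have hc : ∀ i, ContinuousOn (fun t => z t i - Real.exp (-t) * z 0 i) (Ici 0) := fun i =>
    ContinuousOn.sub (fun t ht => (hzi i t ht).continuousWithinAt) (by fun_prop)
  set Z : Fin n → Sig := fun i => Sig.of _ (hc i) with hZ
  set f : Fin n → Sig := fun i => Sig.of (fun t => Real.exp (-t) * ((A *ᵥ z 0) i + z 0 i))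
    (by fun_prop) with hf
  have key := hA.eq_sum_resolvent_smul (z := Z) (f := f)
    (fun i => by rw [hZ, Sig.of_apply _ le_rfl]; simp) (fun i t ht => by
      have h1 : HasDerivAt (fun t => Real.exp (-t) * z 0 i) (-Real.exp (-t) * z 0 i) t := by
        have := ((hasDerivAt_id t).neg.exp).mul_const (z 0 i)
        simpa using this
      have h2 := (hzi i t ht).sub h1.hasDerivWithinAt
      have h3 : HasDerivWithinAt (Z i).1 ((A *ᵥ z t) i - -Real.exp (-t) * z 0 i) (Ici 0) t :=
        h2.congr (fun τ hτ => Sig.of_apply (hc i) hτ) (Sig.of_apply (hc i) ht)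
      refine h3.congr_deriv ?_
      simp only [hZ, hf, Sig.of_apply _ ht, Matrix.mulVec, dotProduct, mul_sub,
        Finset.sum_sub_distrib, mul_add, Finset.mul_sum]
      have : ∑ j, A i j * (Real.exp (-t) * z 0 j) = ∑ j, Real.exp (-t) * (A i j * z 0 j) :=
        Finset.sum_congr rfl fun j _ => by ring
      rw [this]
      ring)
  have hexp : ∀ t : ℝ, 0 ≤ t → Real.exp (-t) ≤ 1 := fun t ht => by simpa using ht
  have hfb : ∀ i t, 0 ≤ t → |(f i).1 t| ≤ |(A *ᵥ z 0) i + z 0 i| := fun i t ht => by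
    simp only [hf, Sig.of_apply _ ht, abs_mul, abs_of_pos (Real.exp_pos _)]
    exact mul_le_of_le_one_left (abs_nonneg _) (hexp t ht)
  have hb : ∀ i, ∃ M : ℝ, ∀ t, 0 ≤ t → |z t i| ≤ M := fun i => by
    refine ⟨∑ j, (|(hA.resolvent i j).feed| + ∫ t in Ici (0 : ℝ), |(hA.resolvent i j).ker t|) *
      |(A *ᵥ z 0) j + z 0 j| + |z 0 i|, fun t ht => ?_⟩
    have e : z t i = (Z i).1 t + Real.exp (-t) * z 0 i := by
      rw [hZ, Sig.of_apply _ ht]; ring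
    rw [e]
    refine (abs_add_le _ _).trans (add_le_add ?_ ?_)
    · rw [key i, Sig.sum_apply]
      refine (Finset.abs_sum_le_sum_abs _ _).trans (Finset.sum_le_sum fun j _ => ?_)
      exact abs_smul_le (hA.resolvent i j).isImpulseResponse
        (fun s => ((hA.resolvent i j).tf_apply s).symm) _ (hfb j) t
    · rw [abs_mul, abs_of_pos (Real.exp_pos _)]
      exact mul_le_of_le_one_left (abs_nonneg _) (hexp t ht)
  choose M hM using hb
  refine ⟨∑ i, |M i|, fun t ht i => (hM i t ht).trans ((le_abs_self _).trans ?_)⟩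
  exact Finset.single_le_sum (f := fun i => |M i|) (fun j _ => abs_nonneg _) (Finset.mem_univ i)

end Resolvent

/-! ### The Lyapunov equation -/

section Lyapunov

variable {n : ℕ} {A P Q : Matrix (Fin n) (Fin n) ℝ}

lemma hasDerivWithinAt_dotProduct {u v : ℝ → Fin n → ℝ} {u' v' : Fin n → ℝ} {s : Set ℝ} {t : ℝ}
    (hu : HasDerivWithinAt u u' s t) (hv : HasDerivWithinAt v v' s t) :
    HasDerivWithinAt (fun τ => u τ ⬝ᵥ v τ) (u' ⬝ᵥ v t + u t ⬝ᵥ v') s t := by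
  have := HasDerivWithinAt.fun_sum (u := Finset.univ) fun i _ =>
    (hasDerivWithinAt_pi.1 hu i).mul (hasDerivWithinAt_pi.1 hv i)
  refine this.congr_deriv ?_
  simp only [dotProduct, Finset.sum_add_distrib]

lemma hasDerivWithinAt_mulVec (P : Matrix (Fin n) (Fin n) ℝ) {u : ℝ → Fin n → ℝ} {u' : Fin n → ℝ}
    {s : Set ℝ} {t : ℝ} (hu : HasDerivWithinAt u u' s t) :
    HasDerivWithinAt (fun τ => P *ᵥ u τ) (P *ᵥ u') s t := by
  rw [hasDerivWithinAt_pi]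
  intro i
  exact HasDerivWithinAt.fun_sum (u := Finset.univ) fun j _ =>
    (hasDerivWithinAt_pi.1 hu j).const_mul (P i j)

lemma lyapunov_form (h : Aᵀ * P + P * A = -Q) (z : Fin n → ℝ) :
    (A *ᵥ z) ⬝ᵥ (P *ᵥ z) + z ⬝ᵥ (P *ᵥ (A *ᵥ z)) = -(z ⬝ᵥ (Q *ᵥ z)) := by
  have h1 : (A *ᵥ z) ⬝ᵥ (P *ᵥ z) = z ⬝ᵥ ((Aᵀ * P) *ᵥ z) := by
    rw [← Matrix.mulVec_mulVec, Matrix.dotProduct_mulVec z, Matrix.vecMul_transpose]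
  rw [h1, Matrix.mulVec_mulVec, ← dotProduct_add, ← Matrix.add_mulVec, h, Matrix.neg_mulVec,
    dotProduct_neg]

lemma aeval_mul_eq_mul_aeval {A B M : Matrix (Fin n) (Fin n) ℝ} (h : B * M = M * A)
    (p : Polynomial ℝ) : Polynomial.aeval B p * M = M * Polynomial.aeval A p := by
  induction p using Polynomial.induction_on' with
  | add p q hp hq => rw [map_add, map_add, add_mul, mul_add, hp, hq]
  | monomial k a =>
    have hk : B ^ k * M = M * A ^ k := by
      induction k with
      | zero => simp
      | succ k ih => rw [pow_succ, mul_assoc, h, ← mul_assoc, ih, mul_assoc, ← pow_succ]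
    rw [Polynomial.aeval_monomial, Polynomial.aeval_monomial, mul_assoc, hk, ← mul_assoc,
      ← mul_assoc, Algebra.commutes]

/-- With `A` Hurwitz, the homogeneous Lyapunov equation has only the zero solution. -/
lemma IsHurwitz.eq_zero_of_lyapunov (hA : IsHurwitz A) {M : Matrix (Fin n) (Fin n) ℝ}
    (hM : Aᵀ * M + M * A = 0) : M = 0 := by
  have h1 : Aᵀ * M = M * (-A) := by rw [mul_neg]; exact eq_neg_of_add_eq_zero_left hM
  -- With χ the characteristic polynomial of A, the intertwining gives χ(Aᵀ)M = Mχ(-A), whose left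
  -- side vanishes by Cayley–Hamilton. Since χ(s) and χ(-s) have their roots in opposite
  -- half-planes, they are coprime, so χ(-A) is invertible.
  have h2 := aeval_mul_eq_mul_aeval h1 A.charpoly
  rw [← Matrix.charpoly_transpose, Matrix.aeval_self_charpoly, zero_mul,
    Matrix.charpoly_transpose] at h2
  have hco : IsCoprime A.charpoly (A.charpoly.comp (-Polynomial.X)) := by
    refine (Polynomial.isCoprime_iff_aeval_ne_zero_of_isAlgClosed ℝ ℂ _ _).2 fun z => ?_
    by_contra! hz
    have r1 := hA.isStablePoly_charpoly z hz.1
    have r2 := hA.isStablePoly_charpoly (-z) (by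
      have := hz.2
      rw [Polynomial.aeval_comp] at this
      simpa using this)
    rw [Complex.neg_re] at r2
    linarith
  obtain ⟨u, v, huv⟩ := hco
  have h3 := congrArg (Polynomial.aeval A) huv
  rw [map_add, map_mul, map_mul, Matrix.aeval_self_charpoly, mul_zero, zero_add,
    Polynomial.aeval_comp, map_one, map_neg, Polynomial.aeval_X] at h3
  have h4 : Polynomial.aeval (-A) A.charpoly * Polynomial.aeval A v = 1 :=
    mul_eq_one_comm.1 h3
  rw [← mul_one M, ← h4, ← mul_assoc, ← h2, zero_mul]

/-- Pᵀ solves the same equation, and the solution is unique. -/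
lemma IsHurwitz.lyapunov_symm (hA : IsHurwitz A) (hQ : Q.PosDef) (h : Aᵀ * P + P * A = -Q) :
    Pᵀ = P := by
  have hQt : Qᵀ = Q := by simpa [Matrix.IsHermitian] using hQ.1
  have h' : Aᵀ * Pᵀ + Pᵀ * A = -Q := by
    have := congrArg Matrix.transpose h
    rw [Matrix.transpose_add, Matrix.transpose_mul, Matrix.transpose_mul, Matrix.transpose_transpose,
      Matrix.transpose_neg, hQt] at this
    rw [add_comm, this]
  refine sub_eq_zero.1 (hA.eq_zero_of_lyapunov ?_)
  rw [mul_sub, sub_mul, sub_add_sub_comm, h', h, sub_self]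

lemma lambdaMin_mem_spectrum (hn : 1 ≤ n) (hP : P.IsHermitian) : lambdaMin P ∈ spectrum ℝ P := by
  have : Nonempty (Fin n) := ⟨⟨0, hn⟩⟩
  rw [lambdaMin, hP.spectrum_real_eq_range_eigenvalues]
  exact (range_nonempty _).csInf_mem (finite_range _)

lemma lambdaMin_mul_le (hP : P.IsHermitian) (z : Fin n → ℝ) :
    lambdaMin P * ∑ i, z i ^ 2 ≤ z ⬝ᵥ (P *ᵥ z) := by
  have hpsd : (P - algebraMap ℝ (Matrix (Fin n) (Fin n) ℝ) (lambdaMin P)).PosSemidef := by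
    rw [Matrix.posSemidef_iff_isHermitian_and_spectrum_nonneg]
    refine ⟨hP.sub ?_, ?_⟩
    · rw [Matrix.algebraMap_eq_diagonal]
      exact Matrix.isHermitian_diagonal _
    · rw [← spectrum.sub_singleton_eq]
      rintro _ ⟨a, ha, _, rfl, rfl⟩
      have hb : BddBelow (spectrum ℝ P) := by
        rw [hP.spectrum_real_eq_range_eigenvalues]
        exact (finite_range _).bddBelow
      exact sub_nonneg.2 (csInf_le hb ha)
  have := hpsd.dotProduct_mulVec_nonneg z
  rw [Matrix.sub_mulVec, dotProduct_sub, Algebra.algebraMap_eq_smul_one, Matrix.smul_mulVec,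
    Matrix.one_mulVec, dotProduct_smul, star_trivial, sub_nonneg, smul_eq_mul] at this
  refine le_trans (le_of_eq ?_) this
  simp only [dotProduct, sq]

lemma lambdaMin_pos (hn : 1 ≤ n) (hP : P.PosDef) : 0 < lambdaMin P := by
  have := lambdaMin_mem_spectrum hn hP.1
  rw [hP.1.spectrum_real_eq_range_eigenvalues] at this
  obtain ⟨i, hi⟩ := this
  rw [← hi]
  exact hP.eigenvalues_pos i

lemma abs_dotProduct_mulVec_le (P : Matrix (Fin n) (Fin n) ℝ) {z : Fin n → ℝ} {m : ℝ}
    (hm : ∀ i j, |z i * z j| ≤ m) : |z ⬝ᵥ (P *ᵥ z)| ≤ (∑ i, ∑ j, |P i j|) * m := by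
  simp only [dotProduct, Matrix.mulVec, Finset.mul_sum, Finset.sum_mul]
  refine (Finset.abs_sum_le_sum_abs _ _).trans (Finset.sum_le_sum fun i _ =>
    (Finset.abs_sum_le_sum_abs _ _).trans (Finset.sum_le_sum fun j _ => ?_))
  rw [show z i * (P i j * z j) = P i j * (z i * z j) by ring, abs_mul]
  exact mul_le_mul_of_nonneg_left (hm i j) (abs_nonneg _)

attribute [local instance] Matrix.linftyOpNormedRing Matrix.linftyOpNormedAlgebra in
lemma hasDerivAt_exp_smul_mulVec (A : Matrix (Fin n) (Fin n) ℝ) (x : Fin n → ℝ) (t : ℝ) :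
    HasDerivAt (fun τ : ℝ => NormedSpace.exp (τ • A) *ᵥ x) (A *ᵥ (NormedSpace.exp (t • A) *ᵥ x))
      t := by
  have h := hasDerivAt_exp_smul_const' (𝕂 := ℝ) A t
  let L : Matrix (Fin n) (Fin n) ℝ →ₗ[ℝ] (Fin n → ℝ) :=
    { toFun := fun M => M *ᵥ x
      map_add' := fun M N => Matrix.add_mulVec M N x
      map_smul' := fun c M => Matrix.smul_mulVec c M x }
  have := (LinearMap.toContinuousLinearMap L).hasFDerivAt.comp_hasDerivAt t h
  refine this.congr_deriv ?_
  exact (Matrix.mulVec_mulVec x A (NormedSpace.exp (t • A))).symm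

/-- The solution of the Lyapunov equation of a Hurwitz matrix is positive definite. -/
lemma IsHurwitz.posDef_of_lyapunov (hn : 1 ≤ n) (hA : IsHurwitz A) (hQ : Q.PosDef)
    (h : Aᵀ * P + P * A = -Q) : P.PosDef := by
  have hsymm := hA.lyapunov_symm hQ h
  refine Matrix.PosDef.of_dotProduct_mulVec_pos (by simpa [Matrix.IsHermitian] using hsymm)
    fun x hx => ?_
  rw [star_trivial]
  -- If xᵀPx ≤ 0, then W = -zᵀPz along z = e^{tA}x starts nonnegative and increases at rate zᵀQz.
  -- That rate stays above a positive constant from time 1 on, so W grows linearly, contradicting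
  -- boundedness of z.
  by_contra! hneg
  set z : ℝ → Fin n → ℝ := fun t => NormedSpace.exp (t • A) *ᵥ x with hz
  have hz0 : z 0 = x := by simp [hz]
  have hzne : ∀ t, z t ≠ 0 := fun t ht => by
    have := Matrix.isUnit_exp (t • A)
    rw [Matrix.isUnit_iff_isUnit_det] at this
    exact hx (Matrix.mulVec_injective_of_isUnit ((Matrix.isUnit_iff_isUnit_det _).2 this)
      (by simpa [hz] using ht))
  have hzd : ∀ t, HasDerivAt z (A *ᵥ z t) t := hasDerivAt_exp_smul_mulVec A x
  obtain ⟨M, hM⟩ := hA.exists_bound fun t _ => (hzd t).hasDerivWithinAt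
  set W : ℝ → ℝ := fun t => -(z t ⬝ᵥ (P *ᵥ z t)) with hW
  have hWd : ∀ t, HasDerivAt W (z t ⬝ᵥ (Q *ᵥ z t)) t := fun t => by
    have h1 := (hasDerivWithinAt_univ.2 (hzd t))
    have h2 := (hasDerivWithinAt_dotProduct h1 (hasDerivWithinAt_mulVec P h1)).neg
    rw [hasDerivWithinAt_univ, lyapunov_form h, neg_neg] at h2
    exact h2
  have hpos : ∀ t, 0 < z t ⬝ᵥ (Q *ᵥ z t) := fun t => by
    simpa using hQ.dotProduct_mulVec_pos (hzne t)
  have hmono : StrictMono W := strictMono_of_deriv_pos fun t => by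
    rw [(hWd t).deriv]; exact hpos t
  have hW0 : 0 ≤ W 0 := by simp only [hW, hz0]; linarith
  have hW1 : 0 < W 1 := hW0.trans_lt (hmono one_pos)
  set p := (∑ i, ∑ j, |P i j|) + 1 with hp
  have hp0 : 0 < p := by positivity
  have hq := lambdaMin_pos hn hQ
  -- For t ≥ 1, W(1) ≤ W(t) ≤ p|z|² bounds |z|² below, hence also zᵀQz. The summand 1 in p keeps the
  -- divisor positive.
  set c := lambdaMin Q * (W 1 / p) with hc
  have hc0 : 0 < c := by positivity
  have hgrow : ∀ t, 1 ≤ t → c ≤ z t ⬝ᵥ (Q *ᵥ z t) := fun t ht => by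
    refine le_trans ?_ (lambdaMin_mul_le hQ.1 (z t))
    refine mul_le_mul_of_nonneg_left ?_ hq.le
    rw [div_le_iff₀ hp0]
    have hn0 : 0 ≤ ∑ i, z t i ^ 2 := Finset.sum_nonneg fun i _ => sq_nonneg _
    have h1 : |z t ⬝ᵥ (P *ᵥ z t)| ≤ (∑ i, ∑ j, |P i j|) * ∑ i, z t i ^ 2 := by
      refine abs_dotProduct_mulVec_le P fun i j => ?_
      have hi : z t i ^ 2 ≤ ∑ i, z t i ^ 2 :=
        Finset.single_le_sum (f := fun i => z t i ^ 2) (fun k _ => sq_nonneg _) (Finset.mem_univ i)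
      have hj : z t j ^ 2 ≤ ∑ i, z t i ^ 2 :=
        Finset.single_le_sum (f := fun i => z t i ^ 2) (fun k _ => sq_nonneg _) (Finset.mem_univ j)
      rw [abs_le]
      constructor <;> nlinarith [sq_nonneg (z t i + z t j), sq_nonneg (z t i - z t j)]
    have h2 : W 1 ≤ W t := hmono.monotone ht
    have h3 : W t ≤ |z t ⬝ᵥ (P *ᵥ z t)| := neg_le_abs _
    rw [hp]
    linarith
  have hlin : ∀ t, 1 ≤ t → c * (t - 1) ≤ W t - W 1 := fun t ht => by
    have hf : ∀ t, HasDerivAt (fun t => W t - c * t) (z t ⬝ᵥ (Q *ᵥ z t) - c * 1) t := fun t =>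
      (hWd t).sub ((hasDerivAt_id t).const_mul c)
    have := monotoneOn_of_deriv_nonneg (convex_Ici (1 : ℝ)) (f := fun t => W t - c * t)
      (fun t _ => (hf t).continuousAt.continuousWithinAt)
      (fun t _ => (hf t).differentiableAt.differentiableWithinAt)
      (fun t ht => by
        rw [interior_Ici, mem_Ioi] at ht
        rw [(hf t).deriv]
        linarith [hgrow t ht.le]) (mem_Ici.2 le_rfl) (mem_Ici.2 ht) ht
    simp only at this
    linarith
  have hbd : ∀ t, 0 ≤ t → W t ≤ (∑ i, ∑ j, |P i j|) * M ^ 2 := fun t ht => by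
    refine (neg_le_abs _).trans (abs_dotProduct_mulVec_le P fun i j => ?_)
    rw [abs_mul, sq]
    exact mul_le_mul (hM t ht i) (hM t ht j) (abs_nonneg _) ((abs_nonneg _).trans (hM t ht i))
  set B := (∑ i, ∑ j, |P i j|) * M ^ 2 with hB
  have hB0 : 0 ≤ B := by positivity
  -- At this time linear growth gives W ≥ W(1) + B, with W(1) > 0, while W ≤ B.
  have ht : (1 : ℝ) ≤ 1 + B / c := by
    have : 0 ≤ B / c := by positivity
    linarith
  have e1 := hlin _ ht
  have e2 := hbd (1 + B / c) (by linarith)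
  rw [add_sub_cancel_left, mul_div_cancel₀ _ hc0.ne'] at e1
  linarith

end Lyapunov

/-! ### The prediction error -/

section Projection

variable {n : ℕ} {Ω : Set (Fin n → ℝ)} {θ y v : Fin n → ℝ}

/-- By convexity a(z' - θ) + ε(z - θ) is a + ε times the difference of a point of Ω and θ; the
closure follows by continuity. Membership of θ in Ω plays no role, so invariance of Ω under the
adaptation is never needed. -/
lemma add_smul_mem_tangentCone (hΩ : Convex ℝ Ω) {z : Fin n → ℝ} (hz : z ∈ Ω) {ε : ℝ}
    (hε : 0 < ε) (hv : v ∈ tangentCone Ω θ) : v + ε • (z - θ) ∈ tangentCone Ω θ := by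
  refine map_mem_closure (f := fun v => v + ε • (z - θ)) (by fun_prop) hv ?_
  rintro _ ⟨a, ha, z', hz', rfl⟩
  have hpos : 0 < a + ε := by linarith
  refine ⟨a + ε, hpos.le, (a / (a + ε)) • z' + (ε / (a + ε)) • z,
    hΩ hz' hz (by positivity) (by positivity) (by field_simp), ?_⟩
  ext i
  simp only [Pi.add_apply, Pi.smul_apply, Pi.sub_apply, smul_eq_mul]
  field_simp
  ring

/-- The variational inequality of the projection onto the tangent cone. -/
lemma IsProj.inner_le (h : IsProj Ω θ y v) (hΩ : Convex ℝ Ω) {z : Fin n → ℝ} (hz : z ∈ Ω) :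
    (θ - z) ⬝ᵥ v ≤ (θ - z) ⬝ᵥ y := by
  -- Compare v with the competitor v + ε(z - θ), expand the square, divide by ε; then ε → 0.
  have key : ∀ ε : ℝ, 0 < ε →
      2 * ∑ i, (y i - v i) * (z i - θ i) ≤ ε * ∑ i, (z i - θ i) ^ 2 := fun ε hε => by
    have h1 := h.2 _ (add_smul_mem_tangentCone hΩ hz hε h.1)
    have h2 : ∑ i, (y i - (v + ε • (z - θ)) i) ^ 2 = ∑ i, (y i - v i) ^ 2 -
        ε * (2 * ∑ i, (y i - v i) * (z i - θ i)) + ε * (ε * ∑ i, (z i - θ i) ^ 2) := by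
      simp only [Finset.mul_sum, ← Finset.sum_sub_distrib, ← Finset.sum_add_distrib]
      refine Finset.sum_congr rfl fun i _ => ?_
      simp only [Pi.add_apply, Pi.smul_apply, Pi.sub_apply, smul_eq_mul]
      ring
    rw [h2] at h1
    have : ε * (2 * ∑ i, (y i - v i) * (z i - θ i)) ≤ ε * (ε * ∑ i, (z i - θ i) ^ 2) := by
      linarith
    exact le_of_mul_le_mul_left this hε
  have hle : 2 * ∑ i, (y i - v i) * (z i - θ i) ≤ 0 := by
    have ht : Tendsto (fun ε : ℝ => ε * ∑ i, (z i - θ i) ^ 2) (𝓝[>] 0) (𝓝 0) := by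
      have : Continuous fun ε : ℝ => ε * ∑ i, (z i - θ i) ^ 2 := by fun_prop
      have := (this.tendsto 0).mono_left (nhdsWithin_le_nhds (s := Ioi 0))
      simpa using this
    refine ge_of_tendsto ht ?_
    filter_upwards [self_mem_nhdsWithin] with ε hε using key ε hε
  have e : (θ - z) ⬝ᵥ v - (θ - z) ⬝ᵥ y = ∑ i, (y i - v i) * (z i - θ i) := by
    simp only [dotProduct, ← Finset.sum_sub_distrib, Pi.sub_apply]
    exact Finset.sum_congr rfl fun i _ => by ring
  linarith

end Projection

/-- The integrand g is merely integrable, as for a Carathéodory solution, so the chain rule for the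
square comes from the product rule for absolutely continuous functions. -/
lemma sq_sub_sq_eq_integral {g : ℝ → ℝ} {t : ℝ} (a : ℝ) (hg : IntervalIntegrable g volume 0 t) :
    (a + ∫ τ in (0 : ℝ)..t, g τ) ^ 2 - a ^ 2 =
      ∫ σ in (0 : ℝ)..t, 2 * ((a + ∫ τ in (0 : ℝ)..σ, g τ) * g σ) := by
  have hac := hg.absolutelyContinuousOnInterval_intervalIntegral (c := 0) (by simp)
  have h1 := hac.integral_deriv_mul_eq_sub hac
  have h2 : ∫ σ in (0 : ℝ)..t, 2 * ((∫ τ in (0 : ℝ)..σ, g τ) * g σ) =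
      (∫ τ in (0 : ℝ)..t, g τ) * (∫ τ in (0 : ℝ)..t, g τ) := by
    rw [intervalIntegral.integral_same, mul_zero, sub_zero] at h1
    rw [← h1]
    refine intervalIntegral.integral_congr_ae ?_
    filter_upwards [hg.ae_hasDerivAt_integral] with σ hσ hσ'
    rw [(hσ (uIoc_subset_uIcc hσ') 0 (by simp)).deriv]
    ring
  have i1 : IntervalIntegrable (fun σ => 2 * ((∫ τ in (0 : ℝ)..σ, g τ) * g σ)) volume 0 t :=
    (hg.continuousOn_mul hac.continuousOn).const_mul 2
  have i2 : IntervalIntegrable (fun σ => 2 * a * g σ) volume 0 t := hg.const_mul _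
  have h3 : (fun σ => 2 * ((a + ∫ τ in (0 : ℝ)..σ, g τ) * g σ)) =
      fun σ => 2 * ((∫ τ in (0 : ℝ)..σ, g τ) * g σ) + 2 * a * g σ := by
    ext σ; ring
  rw [h3, intervalIntegral.integral_add i1 i2, h2, intervalIntegral.integral_const_mul]
  ring

/-! ### The Lyapunov estimate along the closed loop -/

namespace Setup

variable {n : ℕ} {S : Setup n} {x xhat θhat : ℝ → Fin n → ℝ} {u u₂ : ℝ → ℝ}

lemma Am_mulVec (z : Fin n → ℝ) : S.Am *ᵥ z = S.A *ᵥ z - (S.K ⬝ᵥ z) • S.b := by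
  rw [Am, Matrix.sub_mulVec, Matrix.vecMulVec_mulVec, op_smul_eq_smul]

lemma IsClosedLoop.hasDerivWithinAt (hx : S.IsClosedLoop x xhat θhat u u₂) {t : ℝ} (ht : 0 ≤ t) :
    HasDerivWithinAt x (S.Am *ᵥ x t + (u₂ t - S.θ ⬝ᵥ x t) • S.b) (Ici 0) t := by
  refine (hx.plant.2 t ht).congr_deriv ?_
  rw [Am_mulVec, hx.control t ht]
  module

/-- u₂ drives plant and predictor identically and cancels; only the parameter mismatch remains. -/
lemma IsClosedLoop.hasDerivWithinAt_error (hx : S.IsClosedLoop x xhat θhat u u₂) {t : ℝ}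
    (ht : 0 ≤ t) :
    HasDerivWithinAt (fun t => xhat t - x t)
      (S.Am *ᵥ (xhat t - x t) + (-((θhat t - S.θ) ⬝ᵥ x t)) • S.b) (Ici 0) t := by
  refine ((hx.predictor t ht).sub (hx.hasDerivWithinAt ht)).congr_deriv ?_
  rw [Matrix.mulVec_sub, sub_dotProduct]
  module

lemma IsClosedLoop.continuousOn (hx : S.IsClosedLoop x xhat θhat u u₂) :
    ContinuousOn x (Ici 0) := fun t ht => (hx.plant.2 t ht).continuousWithinAt

lemma IsClosedLoop.continuousOn_estimate (hx : S.IsClosedLoop x xhat θhat u u₂) :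
    ContinuousOn θhat (Ici 0) := by
  obtain ⟨v, -, hv⟩ := hx.adaptation
  have h : ∀ T, 0 ≤ T → ContinuousOn θhat (Icc 0 T) := fun T hT => by
    have hi : IntegrableOn (fun τ => S.Γc • v τ) (uIcc 0 T) := by
      have := (hv T hT).1.smul S.Γc
      rwa [intervalIntegrable_iff_integrableOn_Icc_of_le hT, ← uIcc_of_le hT] at this
    have hc := intervalIntegral.continuousOn_primitive_interval hi
    rw [uIcc_of_le hT] at hc
    exact (continuousOn_const.add hc).congr fun t ht => (hv t ht.1).2
  intro t ht
  have := h (t + 1) (by linarith [mem_Ici.1 ht]) t ⟨ht, by linarith⟩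
  refine this.mono_of_mem_nhdsWithin ?_
  rw [← Ici_inter_Iic]
  exact inter_mem_nhdsWithin _ (Iic_mem_nhds (by linarith))

/-- The Lyapunov function `x̃ᵀ P x̃ + |θ̃|² / Γ_c` does not exceed its initial value. -/
lemma IsClosedLoop.lyapunov_le (hS : S.Standing) (hx : S.IsClosedLoop x xhat θhat u u₂) {t : ℝ}
    (ht : 0 ≤ t) :
    (xhat t - x t) ⬝ᵥ (S.P *ᵥ (xhat t - x t)) ≤ S.Γc⁻¹ * ∑ i, (S.θhat₀ i - S.θ i) ^ 2 := by
  obtain ⟨v, hproj, hv⟩ := hx.adaptation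
  have hsymm := hS.hurwitz.lyapunov_symm hS.Q_posDef hS.lyapunov
  have hΓ := hS.Γc_pos
  set e : ℝ → Fin n → ℝ := fun t => xhat t - x t with he
  set w : ℝ → ℝ := fun t => (θhat t - S.θ) ⬝ᵥ x t with hw
  have hed : ∀ t, 0 ≤ t → HasDerivWithinAt e (S.Am *ᵥ e t + (-w t) • S.b) (Ici 0) t :=
    fun t ht => hx.hasDerivWithinAt_error ht
  have he0 : e 0 = 0 := by simp [he, hx.predictor_init, hx.plant.1]
  have hVd : ∀ t, 0 ≤ t → HasDerivWithinAt (fun t => e t ⬝ᵥ (S.P *ᵥ e t))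
      (-(e t ⬝ᵥ (S.Q *ᵥ e t)) - 2 * (w t * (e t ⬝ᵥ (S.P *ᵥ S.b)))) (Ici 0) t := fun t ht => by
    refine (hasDerivWithinAt_dotProduct (hed t ht)
      (hasDerivWithinAt_mulVec S.P (hed t ht))).congr_deriv ?_
    have h1 : S.b ⬝ᵥ (S.P *ᵥ e t) = e t ⬝ᵥ (S.P *ᵥ S.b) := by
      rw [Matrix.dotProduct_mulVec, dotProduct_comm, ← Matrix.mulVec_transpose, hsymm]
    rw [Matrix.mulVec_add, add_dotProduct, dotProduct_add, ← lyapunov_form hS.lyapunov,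
      Matrix.mulVec_smul, smul_dotProduct, dotProduct_smul, h1]
    simp only [smul_eq_mul]
    ring
  have hec : ContinuousOn e (Ici 0) := fun t ht => (hed t ht).continuousWithinAt
  have hwc : ContinuousOn w (Ici 0) := by
    have h1 := hx.continuousOn_estimate
    have h2 := hx.continuousOn
    simp only [hw, dotProduct, Pi.sub_apply]
    fun_prop
  have hsub : Icc 0 t ⊆ Ici (0 : ℝ) := Icc_subset_Ici_self
  have hVc : ContinuousOn (fun t => -(e t ⬝ᵥ (S.Q *ᵥ e t)) -
      2 * (w t * (e t ⬝ᵥ (S.P *ᵥ S.b)))) (Ici 0) := by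
    simp only [dotProduct, Matrix.mulVec]
    fun_prop
  have hVi : IntervalIntegrable (fun t => -(e t ⬝ᵥ (S.Q *ᵥ e t)) -
      2 * (w t * (e t ⬝ᵥ (S.P *ᵥ S.b)))) volume 0 t := by
    apply ContinuousOn.intervalIntegrable
    rw [uIcc_of_le ht]
    exact hVc.mono hsub
  have hV := intervalIntegral.integral_eq_sub_of_hasDeriv_right_of_le ht
    (fun τ hτ => ((hVd τ hτ.1).mono hsub).continuousWithinAt)
    (fun τ hτ => (hVd τ hτ.1.le).mono (Ioi_subset_Ici hτ.1.le)) hVi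
  simp only [he0, zero_dotProduct, sub_zero] at hV
  have hvi : ∀ i, IntervalIntegrable (fun τ => S.Γc * v τ i) volume 0 t := fun i => by
    have := (hv t ht).1
    rw [intervalIntegrable_iff] at this ⊢
    exact (Integrable.eval this i).const_mul _
  have hθ : ∀ τ ∈ Icc 0 t, ∀ i, θhat τ i - S.θ i =
      (S.θhat₀ i - S.θ i) + ∫ σ in (0 : ℝ)..τ, S.Γc * v σ i := fun τ hτ i => by
    have h1 := (hv τ hτ.1).2
    have h2 : (∫ σ in (0 : ℝ)..τ, S.Γc • v σ) i = ∫ σ in (0 : ℝ)..τ, S.Γc * v σ i := by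
      have h3 := (hv τ hτ.1).1.smul S.Γc
      have := ContinuousLinearMap.intervalIntegral_comp_comm
        (ContinuousLinearMap.proj (R := ℝ) (φ := fun _ : Fin n => ℝ) i) h3
      simpa using this.symm
    rw [h1, Pi.add_apply, h2]
    ring
  have hsq : ∀ i, (θhat t i - S.θ i) ^ 2 - (S.θhat₀ i - S.θ i) ^ 2 =
      ∫ τ in (0 : ℝ)..t, 2 * ((θhat τ i - S.θ i) * (S.Γc * v τ i)) := fun i => by
    rw [hθ t ⟨ht, le_rfl⟩ i, sq_sub_sq_eq_integral _ (hvi i)]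
    refine intervalIntegral.integral_congr fun τ hτ => ?_
    rw [uIcc_of_le ht] at hτ
    rw [hθ τ hτ i]
  have hsi : ∀ i, IntervalIntegrable (fun τ => 2 * ((θhat τ i - S.θ i) * (S.Γc * v τ i)))
      volume 0 t := fun i => by
    refine ((hvi i).continuousOn_mul ?_).const_mul 2
    rw [uIcc_of_le ht]
    have h1 := hx.continuousOn_estimate.mono hsub
    fun_prop
  have hsum : ∑ i, ((θhat t i - S.θ i) ^ 2 - (S.θhat₀ i - S.θ i) ^ 2) =
      ∫ τ in (0 : ℝ)..t, S.Γc * (2 * ((θhat τ - S.θ) ⬝ᵥ v τ)) := by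
    simp only [hsq]
    rw [← intervalIntegral.integral_finsetSum fun i _ => hsi i]
    congr 1 with τ
    simp only [dotProduct, Finset.mul_sum, Pi.sub_apply]
    exact Finset.sum_congr rfl fun i _ => by ring
  have hIi : IntervalIntegrable (fun τ => 2 * ((θhat τ - S.θ) ⬝ᵥ v τ)) volume 0 t := by
    have := (IntervalIntegrable.sum Finset.univ fun i _ => hsi i).const_mul S.Γc⁻¹
    convert this using 2 with τ
    rw [Finset.sum_apply]
    simp only [dotProduct, Finset.mul_sum, Pi.sub_apply]
    refine Finset.sum_congr rfl fun i _ => ?_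
    field_simp
  rw [intervalIntegral.integral_const_mul] at hsum
  -- The variational inequality, tested at the true θ, gives (θ̂ - θ)ᵀv ≤ (x̃ᵀPb)(θ̂ - θ)ᵀx, which
  -- absorbs the indefinite term of the derivative of x̃ᵀPx̃; what is left is at most -x̃ᵀQx̃.
  have hle : ∫ τ in (0 : ℝ)..t, ((-(e τ ⬝ᵥ (S.Q *ᵥ e τ)) - 2 * (w τ * (e τ ⬝ᵥ (S.P *ᵥ S.b)))) +
      2 * ((θhat τ - S.θ) ⬝ᵥ v τ)) ≤ 0 := by
    have := intervalIntegral.integral_mono_on ht (hVi.add hIi)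
      (intervalIntegrable_const (c := (0 : ℝ))) fun τ hτ => ?_
    · simpa using this
    · have h1 := (hproj τ hτ.1).inner_le hS.convex hS.θ_mem
      rw [dotProduct_smul, smul_eq_mul] at h1
      have h2 : 0 ≤ e τ ⬝ᵥ (S.Q *ᵥ e τ) := by
        simpa using hS.Q_posDef.posSemidef.dotProduct_mulVec_nonneg (e τ)
      have h3 : (e τ ⬝ᵥ (S.P *ᵥ S.b)) * ((θhat τ - S.θ) ⬝ᵥ x τ) =
        w τ * (e τ ⬝ᵥ (S.P *ᵥ S.b)) := mul_comm _ _
      change _ ≤ (e τ ⬝ᵥ (S.P *ᵥ S.b)) * ((θhat τ - S.θ) ⬝ᵥ x τ) at h1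
      rw [h3] at h1
      linarith
  rw [intervalIntegral.integral_add hVi hIi, hV] at hle
  have hI : ∫ τ in (0 : ℝ)..t, 2 * ((θhat τ - S.θ) ⬝ᵥ v τ) =
      S.Γc⁻¹ * ∑ i, ((θhat t i - S.θ i) ^ 2 - (S.θhat₀ i - S.θ i) ^ 2) := by
    rw [hsum]; field_simp
  rw [hI, Finset.sum_sub_distrib, mul_sub] at hle
  have : 0 ≤ S.Γc⁻¹ * ∑ i, (θhat t i - S.θ i) ^ 2 := by positivity
  change e t ⬝ᵥ (S.P *ᵥ e t) ≤ _
  linarith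

lemma Standing.sum_four_sq_le (hS : S.Standing) {ϑ : Fin n → ℝ} (hϑ : ϑ ∈ S.Ω) :
    ∑ i, 4 * ϑ i ^ 2 ≤ S.thetaBarMax :=
  le_csSup (hS.compact.image (by fun_prop)).bddAbove ⟨ϑ, hϑ, rfl⟩

lemma Standing.sum_abs_le (hS : S.Standing) {ϑ : Fin n → ℝ} (hϑ : ϑ ∈ S.Ω) :
    ∑ i, |ϑ i| ≤ S.thetaMax :=
  le_csSup (hS.compact.image (by fun_prop)).bddAbove ⟨ϑ, hϑ, rfl⟩

/-- The uniform bound on the prediction error. -/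
lemma IsClosedLoop.abs_error_le (hn : 1 ≤ n) (hS : S.Standing)
    (hx : S.IsClosedLoop x xhat θhat u u₂) {t : ℝ} (ht : 0 ≤ t) (i : Fin n) :
    |xhat t i - x t i| ≤ √(S.thetaBarMax / lambdaMin S.P) / √S.Γc := by
  have hP := hS.hurwitz.posDef_of_lyapunov hn hS.Q_posDef hS.lyapunov
  have hl := lambdaMin_pos hn hP
  have hΓ := hS.Γc_pos
  have h1 := hx.lyapunov_le hS ht
  have h2 := lambdaMin_mul_le hP.1 (xhat t - x t)
  have h3 : (xhat t i - x t i) ^ 2 ≤ ∑ i, (xhat t - x t) i ^ 2 :=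
    Finset.single_le_sum (f := fun i => (xhat t - x t) i ^ 2) (fun k _ => sq_nonneg _)
      (Finset.mem_univ i)
  -- From (a - b)² ≤ 2a² + 2b², where each of the two sums is at most θ̄_max/2: this is the origin
  -- of the factor 4 in θ̄_max.
  have h4 : ∑ i, (S.θhat₀ i - S.θ i) ^ 2 ≤ S.thetaBarMax := by
    have e1 := hS.sum_four_sq_le hS.θ_mem
    have e2 := hS.sum_four_sq_le hS.θhat₀_mem
    have e3 : ∑ i, (S.θhat₀ i - S.θ i) ^ 2 ≤
        ∑ i, (4 * S.θ i ^ 2 / 2 + 4 * S.θhat₀ i ^ 2 / 2) :=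
      Finset.sum_le_sum fun i _ => by nlinarith [sq_nonneg (S.θhat₀ i + S.θ i)]
    rw [Finset.sum_add_distrib, ← Finset.sum_div, ← Finset.sum_div] at e3
    linarith
  rw [← Real.sqrt_div' _ hΓ.le]
  refine Real.abs_le_sqrt ?_
  rw [div_div, le_div_iff₀ (by positivity)]
  have h5 : lambdaMin S.P * (xhat t i - x t i) ^ 2 ≤ S.Γc⁻¹ * S.thetaBarMax :=
    (mul_le_mul_of_nonneg_left h3 hl.le).trans (h2.trans (h1.trans
      (mul_le_mul_of_nonneg_left h4 (by positivity))))
  rw [inv_mul_eq_div, le_div_iff₀ hΓ] at h5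
  linarith

end Setup

end Analysis

/-! ### Controllability and the choice of an output of relative degree one -/

/-- The columns of the controllability matrix span, so a vector orthogonal to all of them is
orthogonal to itself. -/
lemma IsControllable.eq_zero {n : ℕ} {A : Matrix (Fin n) (Fin n) ℝ} {b : Fin n → ℝ}
    (h : IsControllable A b) {co : Fin n → ℝ} (hco : ∀ k : ℕ, co ⬝ᵥ ((A ^ k) *ᵥ b) = 0) :
    co = 0 := by
  set M : Matrix (Fin n) (Fin n) ℝ := Matrix.of fun i k : Fin n => ((A ^ (k : ℕ)) *ᵥ b) i with hM
  have htop : LinearMap.range M.mulVecLin = ⊤ := by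
    refine Submodule.eq_top_of_finrank_eq ?_
    rw [Module.finrank_fin_fun]
    exact h
  obtain ⟨y, hy⟩ := LinearMap.range_eq_top.1 htop co
  have h0 : co ᵥ* M = 0 := funext fun k => hco k
  have : co ⬝ᵥ co = 0 := by
    nth_rewrite 2 [← hy]
    rw [Matrix.mulVecLin_apply, Matrix.dotProduct_mulVec, h0, zero_dotProduct]
  exact dotProduct_self_eq_zero.1 this

namespace Setup

variable {n : ℕ} (S : Setup n)

open Polynomial

/-- The numerators `adj(s I - A_m) b` of `H_o(s)`. -/
def HoNum (i : Fin n) : ℝ[X] := ∑ j, S.Am.charmatrix.adjugate i j * Polynomial.C (S.b j)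

lemma natDegree_HoNum_lt (i : Fin n) : (S.HoNum i).natDegree < n := by
  refine Nat.lt_of_le_pred i.pos (natDegree_sum_le_of_forall_le _ _ fun j _ => ?_)
  exact (natDegree_mul_C_le _ _).trans (Nat.le_pred_of_lt (natDegree_adjugate_charmatrix_lt _ i j))

lemma Ho_apply (s : ℂ) (i : Fin n) :
    S.Ho s i = ∑ j, resolventMatrix S.Am s i j * (S.b j : ℂ) := rfl

lemma Ho_eq_div (s : ℂ) (i : Fin n) :
    S.Ho s i = aeval s (S.HoNum i) / aeval s S.Am.charpoly := by
  rw [Ho_apply, HoNum, map_sum, Finset.sum_div]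
  refine Finset.sum_congr rfl fun j _ => ?_
  rw [resolventMatrix_apply, map_mul, aeval_C, Complex.coe_algebraMap]
  ring

/-- The i-th row of (XI - A_m) adj(XI - A_m) b = χ b, with χ the characteristic polynomial of A_m.
-/
lemma X_mul_HoNum (i : Fin n) :
    X * S.HoNum i = ∑ j, Polynomial.C (S.Am i j) * S.HoNum j + S.Am.charpoly * Polynomial.C (S.b i) := by
  have h := congrArg (fun M => (M *ᵥ fun j => Polynomial.C (S.b j)) i) (Matrix.mul_adjugate S.Am.charmatrix)
  simp only [← Matrix.mulVec_mulVec, Matrix.smul_mulVec, Matrix.one_mulVec] at h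
  have h1 : (S.Am.charmatrix.adjugate *ᵥ fun j => Polynomial.C (S.b j)) = S.HoNum := rfl
  rw [h1, Matrix.charmatrix, Matrix.sub_mulVec] at h
  simp only [Matrix.scalar_apply, Pi.sub_apply, Matrix.mulVec_diagonal, Pi.smul_apply,
    smul_eq_mul] at h
  exact sub_eq_iff_eq_add'.1 h

/-- The numerator of `c_oᵀ H_o(s)`. -/
def coNum : (Fin n → ℝ) →ₗ[ℝ] degreeLT ℝ n where
  toFun co := ⟨∑ i, Polynomial.C (co i) * S.HoNum i, by
    refine Submodule.sum_mem _ fun i _ => ?_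
    rw [← smul_eq_C_mul]
    refine Submodule.smul_mem _ _ ?_
    rw [mem_degreeLT]
    exact (degree_le_natDegree).trans_lt (by exact_mod_cast S.natDegree_HoNum_lt i)⟩
  map_add' co co' := by
    ext1
    simp [add_mul, Finset.sum_add_distrib]
  map_smul' a co := by
    ext1
    simp [Finset.mul_sum, mul_assoc, smul_eq_C_mul]

lemma coNum_apply (co : Fin n → ℝ) : (S.coNum co : ℝ[X]) = ∑ i, Polynomial.C (co i) * S.HoNum i := rfl

lemma coHo_eq_div (co : Fin n → ℝ) (s : ℂ) :
    S.coHo co s = aeval s (S.coNum co : ℝ[X]) / aeval s S.Am.charpoly := by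
  rw [coNum_apply, map_sum, Finset.sum_div, coHo, dotProduct]
  refine Finset.sum_congr rfl fun i _ => ?_
  rw [Ho_eq_div, map_mul, aeval_C, Complex.coe_algebraMap]
  ring

/-- Multiplying the numerator of c_oᵀH_o by X gives that of c_oᵀA_m H_o plus (c_oᵀb)χ. The former
has degree below n and χ has degree n, so if the total is zero both parts vanish. -/
lemma coNum_vecMul {co : Fin n → ℝ} (h : S.coNum co = 0) :
    S.coNum (co ᵥ* S.Am) = 0 ∧ co ⬝ᵥ S.b = 0 := by
  have h1 : (S.coNum (co ᵥ* S.Am) : ℝ[X]) + S.Am.charpoly * Polynomial.C (co ⬝ᵥ S.b) = 0 := by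
    have h2 : X * (S.coNum co : ℝ[X]) = 0 := by rw [h]; simp
    rw [← h2, coNum_apply, coNum_apply, Finset.mul_sum]
    have : ∀ i, X * (Polynomial.C (co i) * S.HoNum i) =
        ∑ j, Polynomial.C (co i * S.Am i j) * S.HoNum j + S.Am.charpoly * Polynomial.C (co i * S.b i) := fun i => by
      rw [mul_left_comm, X_mul_HoNum, mul_add, Finset.mul_sum]
      simp only [C_mul]
      congr 1
      · exact Finset.sum_congr rfl fun j _ => by ring
      · ring
    simp only [this, Finset.sum_add_distrib, ← Finset.mul_sum]
    rw [Finset.sum_comm]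
    simp only [Matrix.vecMul, dotProduct, map_sum, Finset.sum_mul]
  have hb : co ⬝ᵥ S.b = 0 := by
    by_contra hne
    have hd : (S.Am.charpoly * Polynomial.C (co ⬝ᵥ S.b)).degree = n := by
      rw [degree_mul_C hne, Matrix.charpoly_degree_eq_dim, Fintype.card_fin]
    have hlt := mem_degreeLT.1 (S.coNum (co ᵥ* S.Am)).2
    rw [eq_neg_of_add_eq_zero_left h1, degree_neg, hd] at hlt
    exact lt_irrefl _ hlt
  refine ⟨?_, hb⟩
  rw [hb] at h1
  exact Subtype.ext (by simpa using h1)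

/-- Iterating `coNum_vecMul` gives c_oᵀA_mᵏb = 0 for all k. At each stage c_oᵀb = 0 makes c_oᵀA =
c_oᵀA_m, so the feedback K drops out and controllability of (A, b) applies. -/
lemma coNum_injective (hc : IsControllable S.A S.b) : Function.Injective S.coNum := by
  rw [injective_iff_map_eq_zero]
  intro co hco
  refine hc.eq_zero fun k => ?_
  induction k generalizing co with
  | zero => simpa using (S.coNum_vecMul hco).2
  | succ k ih =>
    obtain ⟨h1, h2⟩ := S.coNum_vecMul hco
    have h3 : co ᵥ* S.A = co ᵥ* S.Am := by
      rw [Am, Matrix.vecMul_sub, Matrix.vecMul_vecMulVec, h2, zero_smul, sub_zero]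
    rw [pow_succ', ← Matrix.mulVec_mulVec, Matrix.dotProduct_mulVec, h3]
    exact ih _ h1

/-- An injective map between spaces of dimension n is onto, so any numerator of degree below n can
be prescribed; (X + 1)ⁿ⁻¹ is stable of degree n - 1. -/
lemma exists_isMinPhaseRelDegOne (hn : 1 ≤ n) (hS : S.Standing) :
    ∃ co : Fin n → ℝ, S.IsMinPhaseRelDegOne co := by
  have hinj : Function.Injective ((degreeLTEquiv ℝ n).toLinearMap ∘ₗ S.coNum) :=
    (degreeLTEquiv ℝ n).injective.comp (S.coNum_injective hS.controllable)
  have hsurj := LinearMap.injective_iff_surjective.1 hinj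
  have hdeg : ((X + Polynomial.C 1 : ℝ[X]) ^ (n - 1)).natDegree = n - 1 := by
    rw [natDegree_pow, natDegree_X_add_C, mul_one]
  have hmem : (X + Polynomial.C 1 : ℝ[X]) ^ (n - 1) ∈ degreeLT ℝ n := by
    rw [mem_degreeLT]
    refine degree_le_natDegree.trans_lt ?_
    rw [hdeg]
    exact_mod_cast Nat.sub_lt hn one_pos
  obtain ⟨co, hco⟩ := hsurj (degreeLTEquiv ℝ n ⟨_, hmem⟩)
  have hco' : S.coNum co = ⟨_, hmem⟩ := (degreeLTEquiv ℝ n).injective hco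
  refine ⟨co, (X + Polynomial.C 1) ^ (n - 1), S.Am.charpoly, fun z hz => ?_,
    hS.hurwitz.isStablePoly_charpoly, ?_, fun s _ => ?_⟩
  · rw [map_pow] at hz
    have h1 : z + 1 = 0 := by simpa using eq_zero_of_pow_eq_zero hz
    rw [eq_neg_of_add_eq_zero_left h1]
    simp
  · rw [hdeg, Matrix.charpoly_natDegree_eq_dim, Fintype.card_fin]
    omega
  · rw [coHo_eq_div, hco']

end Setup

/-! ### Gains of systems with several channels -/

lemma l1Gain_lt_top {ι κ : Type*} [Fintype ι] [Fintype κ] {H : ℂ → Matrix ι κ ℂ}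
    (hH : ∀ i j, ∃ d h, IsImpulseResponse (fun s => H s i j) d h) : l1Gain H < ∞ := by
  refine lt_of_le_of_lt (iSup_le fun i => Finset.single_le_sum
    (f := fun i => ∑ j, sisoL1Gain fun s => H s i j) (fun _ _ => zero_le) (Finset.mem_univ i)) ?_
  exact ENNReal.sum_lt_top.2 fun i _ => ENNReal.sum_lt_top.2 fun j _ => sisoL1Gain_lt_top (hH i j)

/-- The response of a multi-channel system is bounded by its `L₁` gain. -/
lemma ofReal_abs_sum_smul_le {ι κ : Type*} [Fintype κ] {H : ℂ → Matrix ι κ ℂ} {i : ι}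
    {F : κ → StableSys} (hF : ∀ j (s : RHP), (F j).1 s = H s i j) {w : κ → Sig} {N : ℝ≥0∞}
    (hN : N ≠ ∞) (hw : ∀ j t, 0 ≤ t → ENNReal.ofReal |(w j).1 t| ≤ N) (t : ℝ) :
    ENNReal.ofReal |(∑ j, F j • w j).1 t| ≤ l1Gain H * N := by
  rw [Sig.sum_apply]
  have h1 : ENNReal.ofReal |∑ j, (F j • w j).1 t| ≤ ∑ j, ENNReal.ofReal |(F j • w j).1 t| := by
    rw [← ENNReal.ofReal_sum_of_nonneg fun j _ => abs_nonneg _]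
    exact ENNReal.ofReal_le_ofReal (Finset.abs_sum_le_sum_abs _ _)
  refine h1.trans (le_trans ?_
    (mul_le_mul_left (le_iSup (fun i => ∑ j, sisoL1Gain fun s => H s i j) i) N))
  rw [Finset.sum_mul]
  refine Finset.sum_le_sum fun j _ => ?_
  rw [← ENNReal.ofReal_toReal hN]
  exact ofReal_abs_smul_le (hF j) (w j)
    (fun t ht => (ENNReal.ofReal_le_iff_le_toReal hN).1 (hw j t ht)) t

lemma StableSys.exists_impulse_of_eq (F : StableSys) {G : ℂ → ℂ} (h : ∀ s : RHP, F.1 s = G s) :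
    ∃ d h, IsImpulseResponse G d h :=
  ⟨_, _, F.isImpulseResponse.congr fun s hs => by rw [← h ⟨s, hs⟩, ← F.tf_apply]⟩

lemma StableSys.sum_apply {ι : Type*} (t : Finset ι) (F : ι → StableSys) (s : RHP) :
    (∑ i ∈ t, F i).1 s = ∑ i ∈ t, (F i).1 s := by
  rw [AddSubmonoidClass.coe_finsetSum, Finset.sum_apply]

namespace Setup

variable {n : ℕ} {S : Setup n}

/-! ### The transfer functions of the control loop -/

lemma C_eq_div (s : ℂ) :
    S.C s = Polynomial.aeval s S.filter.num / Polynomial.aeval s S.filter.denom := rfl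

lemma Standing.natDegree_num_lt (hS : S.Standing) :
    S.filter.num.natDegree < S.filter.denom.natDegree := by
  -- A zero numerator would break the passage from `degree` to `natDegree`; C(0) = 1 excludes it.
  refine Polynomial.natDegree_lt_natDegree ?_ hS.filter_strictlyProper
  intro h
  have := hS.filter_zero
  rw [RatFunc.eval, h] at this
  simp at this

/-- The filter `C(s)` as a stable system. -/
def Standing.Csys (hS : S.Standing) : StableSys :=
  StableSys.mk S.C (exists_isImpulseResponse_div hS.filter_stable hS.natDegree_num_lt.le)

lemma Standing.exists_isImpulseResponse_Ho (hS : S.Standing) (i : Fin n) :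
    ∃ d h, IsImpulseResponse (fun s => S.Ho s i) d h := by
  obtain ⟨d, h, H⟩ := exists_isImpulseResponse_div (p := S.HoNum i)
    hS.hurwitz.isStablePoly_charpoly
    (by rw [Matrix.charpoly_natDegree_eq_dim, Fintype.card_fin]
        exact (S.natDegree_HoNum_lt i).le)
  exact ⟨d, h, H.congr fun s _ => S.Ho_eq_div s i⟩

/-- The entries of `H_o(s)` as stable systems. -/
def Standing.Hosys (hS : S.Standing) (i : Fin n) : StableSys :=
  StableSys.mk _ (hS.exists_isImpulseResponse_Ho i)

/-- The entries of `Ḡ(s)` as stable systems. -/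
def Standing.Gsys (hS : S.Standing) (i : Fin n) : StableSys := hS.Hosys i * (hS.Csys - 1)

/-- The small-gain estimate `|θᵀ Ḡ(s)| < 1` on the closed right half-plane. -/
lemma Standing.norm_theta_Gbar_lt_one (hS : S.Standing) (hgain : S.GainCondition) {s : ℂ}
    (hs : 0 ≤ s.re) : ‖∑ i, (S.θ i : ℂ) * S.Gbar s i‖ < 1 := by
  have h1 : ENNReal.ofReal ‖∑ i, (S.θ i : ℂ) * S.Gbar s i‖ ≤
      l1Gain (fun s => Matrix.replicateCol Unit (S.Gbar s)) * ENNReal.ofReal S.thetaMax := by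
    have h2 : ‖∑ i, (S.θ i : ℂ) * S.Gbar s i‖ ≤ ∑ i, ‖S.Gbar s i‖ * |S.θ i| := by
      refine (norm_sum_le _ _).trans (Finset.sum_le_sum fun i _ => ?_)
      rw [norm_mul, mul_comm, Complex.norm_real, Real.norm_eq_abs]
    refine (ENNReal.ofReal_le_ofReal h2).trans ?_
    rw [ENNReal.ofReal_sum_of_nonneg fun i _ => by positivity]
    have h3 : ∀ i, ENNReal.ofReal (‖S.Gbar s i‖ * |S.θ i|) ≤
        l1Gain (fun s => Matrix.replicateCol Unit (S.Gbar s)) * ENNReal.ofReal |S.θ i| :=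
      fun i => by
        rw [ENNReal.ofReal_mul (norm_nonneg _)]
        refine mul_le_mul_left ?_ _
        refine le_trans (norm_le_sisoL1Gain (G := fun s => S.Gbar s i)
          ((hS.Gsys i).exists_impulse_of_eq fun s => rfl) hs) ?_
        refine le_trans ?_ (le_iSup (fun i : Fin n => ∑ j : Unit,
          sisoL1Gain fun s => Matrix.replicateCol Unit (S.Gbar s) i j) i)
        simp
    refine (Finset.sum_le_sum fun i _ => h3 i).trans ?_
    rw [← Finset.mul_sum, ← ENNReal.ofReal_sum_of_nonneg fun i _ => abs_nonneg _]
    exact mul_le_mul_right (ENNReal.ofReal_le_ofReal (hS.sum_abs_le hS.θ_mem)) _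
  exact ENNReal.ofReal_lt_one.1 (h1.trans_lt hgain)

lemma Standing.one_sub_theta_Gbar_ne_zero (hS : S.Standing) (hgain : S.GainCondition) {s : ℂ}
    (hs : 0 ≤ s.re) : 1 - ∑ i, (S.θ i : ℂ) * S.Gbar s i ≠ 0 := fun h => by
  have := hS.norm_theta_Gbar_lt_one hgain hs
  rw [← sub_eq_zero.1 h] at this
  simp at this

-- With C = p/q and θᵀH_o = a/χ, one has 1 - θᵀḠ = D/(χq) where D = χq - a(p - q). Strict properness
-- of a/χ gives D the degree of χq, and a zero of D in the closed right half-plane would be a zero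
-- of 1 - θᵀḠ, which small gain forbids. Hence χq/D is proper and stable.
open Polynomial in
lemma Standing.exists_isImpulseResponse_sensitivity (hS : S.Standing) (hgain : S.GainCondition) :
    ∃ d h, IsImpulseResponse (fun s => (1 - ∑ i, (S.θ i : ℂ) * S.Gbar s i)⁻¹) d h := by
  set χ := S.Am.charpoly with hχ
  set q := S.filter.denom with hq
  set p := S.filter.num with hp
  set a : ℝ[X] := (S.coNum S.θ).1 with ha
  have hχs : IsStablePoly χ := hS.hurwitz.isStablePoly_charpoly
  have hqs : IsStablePoly q := hS.filter_stable
  set D := χ * q - a * (p - q) with hD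
  have hdeg : (a * (p - q)).degree < (χ * q).degree := by
    have h1 : a.degree < χ.degree := by
      rw [hχ, Matrix.charpoly_degree_eq_dim, Fintype.card_fin]
      exact mem_degreeLT.1 (S.coNum S.θ).2
    have h2 : (p - q).degree = q.degree := degree_sub_eq_right_of_degree_lt hS.filter_strictlyProper
    rw [degree_mul, degree_mul, h2]
    refine WithBot.add_lt_add_right ?_ h1
    exact degree_ne_bot.2 hqs.ne_zero
  have hDd : D.natDegree = (χ * q).natDegree :=
    natDegree_eq_of_degree_eq (degree_sub_eq_left_of_degree_lt hdeg)
  have key : ∀ s : ℂ, 0 ≤ s.re → aeval s D =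
      aeval s χ * aeval s q * (1 - ∑ i, (S.θ i : ℂ) * S.Gbar s i) := fun s hs => by
    have h1 := hχs.aeval_ne_zero hs
    have h2 := hqs.aeval_ne_zero hs
    have h3 : ∑ i, (S.θ i : ℂ) * S.Gbar s i =
        (aeval s a / aeval s χ) * (aeval s p / aeval s q - 1) := by
      rw [← C_eq_div, ha, hχ, ← coHo_eq_div, coHo, dotProduct, Finset.sum_mul]
      exact Finset.sum_congr rfl fun i _ => by rw [Gbar, mul_assoc]
    rw [h3, hD]
    simp only [map_sub, map_mul]
    field_simp
  have hDs : IsStablePoly D := fun z hz => by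
    by_contra hre
    rw [not_lt] at hre
    rw [key z hre] at hz
    exact mul_ne_zero (mul_ne_zero (hχs.aeval_ne_zero hre) (hqs.aeval_ne_zero hre))
      (hS.one_sub_theta_Gbar_ne_zero hgain hre) hz
  obtain ⟨d, h, H⟩ := exists_isImpulseResponse_div (p := χ * q) hDs hDd.ge
  refine ⟨d, h, H.congr fun s hs => ?_⟩
  have h1 := hχs.aeval_ne_zero hs
  have h2 := hqs.aeval_ne_zero hs
  have h3 := hS.one_sub_theta_Gbar_ne_zero hgain hs
  rw [key s hs, map_mul]
  field_simp

/-- The sensitivity `1 / (1 - θᵀ Ḡ(s))` as a stable system. -/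
def Standing.sens (hS : S.Standing) (hgain : S.GainCondition) : StableSys :=
  StableSys.mk _ (hS.exists_isImpulseResponse_sensitivity hgain)

lemma Standing.sens_mul (hS : S.Standing) (hgain : S.GainCondition) :
    hS.sens hgain * (1 - ∑ i, StableSys.const (S.θ i) * hS.Gsys i) = 1 := by
  refine Subtype.ext (funext fun s => ?_)
  have h1 : (∑ i, StableSys.const (S.θ i) * hS.Gsys i).1 s = ∑ i, (S.θ i : ℂ) * S.Gbar s i := by
    rw [StableSys.sum_apply]; rfl
  change (1 - ∑ i, (S.θ i : ℂ) * S.Gbar s i)⁻¹ *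
    (1 - (∑ i, StableSys.const (S.θ i) * hS.Gsys i).1 s) = 1
  rw [h1]
  exact inv_mul_cancel₀ (hS.one_sub_theta_Gbar_ne_zero hgain s.2)

/-- The entries of `H₂(s)` as stable systems. -/
def Standing.H2sys (hS : S.Standing) (hgain : S.GainCondition) (i j : Fin n) : StableSys :=
  (if i = j then hS.Csys else 0) +
    hS.Gsys i * hS.sens hgain * hS.Csys * StableSys.const (S.θ j)

/-- T = Ḡθᵀ has rank one, so (I - T)⁻¹ = I + κT with κ = 1/(1 - θᵀḠ), by Sherman–Morrison. Since T +
(C - 1)I = C·I - (I - T), the definition collapses to H₂ = C(I - T)⁻¹. -/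
lemma Standing.H2sys_apply (hS : S.Standing) (hgain : S.GainCondition) (i j : Fin n) (s : RHP) :
    (hS.H2sys hgain i j).1 s = S.H2 s i j := by
  set κ : ℂ := (1 - ∑ i, (S.θ i : ℂ) * S.Gbar s i)⁻¹ with hκ
  have hne := hS.one_sub_theta_Gbar_ne_zero hgain s.2
  set T := S.GbarTheta s with hT
  have hTT : T * T = (∑ i, (S.θ i : ℂ) * S.Gbar s i) • T := by
    rw [hT, GbarTheta, Matrix.vecMulVec_mul_vecMulVec]
    ext k l
    simp only [Matrix.vecMulVec_apply, Matrix.smul_apply, smul_eq_mul, dotProduct, Pi.smul_apply]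
    ring
  have hmul : (1 - T) * (1 + κ • T) = 1 := by
    rw [sub_mul, one_mul, mul_add, mul_one, mul_smul_comm, hTT, smul_smul]
    have : κ = 1 + κ * ∑ i, (S.θ i : ℂ) * S.Gbar s i := by
      have := inv_mul_cancel₀ hne
      rw [← hκ, mul_sub, mul_one] at this
      linear_combination this
    nth_rewrite 1 [this]
    module
  have hH2 : S.H2 s = S.C s • (1 + κ • T) := by
    have h1 : T + (S.C s - 1) • (1 : Matrix (Fin n) (Fin n) ℂ) = S.C s • 1 - (1 - T) := by module
    have h2 : IsUnit (1 - T).det := Matrix.isUnit_det_of_right_inverse hmul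
    rw [H2, ← hT, h1, mul_sub, Matrix.nonsing_inv_mul _ h2, Matrix.inv_eq_right_inv hmul,
      mul_smul_comm, mul_one]
    abel
  rw [hH2]
  have hl : (hS.H2sys hgain i j).1 s =
      (if i = j then S.C s else 0) + S.Gbar s i * κ * S.C s * (S.θ j : ℂ) := by
    rw [H2sys]
    split_ifs <;> rfl
  rw [hl, Matrix.smul_apply, Matrix.add_apply, Matrix.one_apply, Matrix.smul_apply, hT, GbarTheta,
    Matrix.vecMulVec_apply]
  simp only [smul_eq_mul]
  split_ifs <;> ring

lemma Standing.γ₁_lt_top (hS : S.Standing) (hgain : S.GainCondition) : S.γ₁ < ∞ :=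
  ENNReal.mul_lt_top (l1Gain_lt_top fun i j =>
    (hS.H2sys hgain i j).exists_impulse_of_eq (hS.H2sys_apply hgain i j)) ENNReal.ofReal_lt_top

/-- The solution of `z' = A_m z + b f`, `z(0) = 0` is the response of `H_o(s)` to `f`. -/
lemma Standing.eq_Hosys_smul (hS : S.Standing) {z : ℝ → Fin n → ℝ} {f : Sig} (hz0 : z 0 = 0)
    (hz : ∀ t, 0 ≤ t → HasDerivWithinAt z (S.Am *ᵥ z t + f.1 t • S.b) (Ici 0) t)
    {Z : Fin n → Sig} (hZ : ∀ i t, 0 ≤ t → (Z i).1 t = z t i) (i : Fin n) :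
    Z i = hS.Hosys i • f := by
  have h1 := hS.hurwitz.eq_sum_resolvent_smul (z := Z) (f := fun j => StableSys.const (S.b j) • f)
    (fun i => by rw [hZ i 0 le_rfl, hz0]; rfl)
    (fun i t ht => by
      have h2 := hasDerivWithinAt_pi.1 (hz t ht) i
      refine (h2.congr (fun τ hτ => hZ i τ hτ) (hZ i t ht)).congr_deriv ?_
      rw [StableSys.const_smul_apply]
      simp only [hZ _ t ht, Pi.add_apply, Pi.smul_apply, smul_eq_mul, Matrix.mulVec, dotProduct]
      ring) i
  rw [h1]
  simp only [← mul_smul]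
  rw [← Finset.sum_smul]
  congr 1
  refine Subtype.ext (funext fun s => ?_)
  rw [StableSys.sum_apply]
  rfl

variable {x xhat θhat : ℝ → Fin n → ℝ} {u u₂ : ℝ → ℝ}
  {xref : ℝ → Fin n → ℝ} {uref : ℝ → ℝ}

/-! ### Comparison with the reference system -/

lemma IsReference.continuousOn (hr : S.IsReference xref uref) : ContinuousOn xref (Ici 0) :=
  fun t ht => (hr.plant.2 t ht).continuousWithinAt

/-- The prediction error `x̃`, the tracking error `e = x - x_ref` and the disturbance
`w = (θ̂ - θ)ᵀ x` satisfy `x̃ = -H_o w`, `e = H_o ((C - 1) θᵀ e + C w)` and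
`u - u_ref = -Kᵀ e + C (θᵀ e + w)`. -/
lemma exists_error_signals (hS : S.Standing) (hx : S.IsClosedLoop x xhat θhat u u₂)
    (hr : S.IsReference xref uref) :
    ∃ (X E : Fin n → Sig) (W : Sig),
      (∀ i t, 0 ≤ t → (X i).1 t = xhat t i - x t i) ∧
      (∀ i t, 0 ≤ t → (E i).1 t = x t i - xref t i) ∧
      (∀ i, X i = -(hS.Hosys i • W)) ∧
      (∀ i, E i = hS.Hosys i • (hS.Csys • (∑ j, StableSys.const (S.θ j) • E j + W) -
        ∑ j, StableSys.const (S.θ j) • E j)) ∧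
      ∀ t, 0 ≤ t → u t - uref t =
        (hS.Csys • (∑ j, StableSys.const (S.θ j) • E j + W) -
          ∑ j, StableSys.const (S.K j) • E j).1 t := by
  have hxc := hx.continuousOn
  have hθc := hx.continuousOn_estimate
  have hrc := hr.continuousOn
  have hec : ContinuousOn (fun t => xhat t - x t) (Ici 0) := fun t ht =>
    (hx.hasDerivWithinAt_error ht).continuousWithinAt
  have hrefc := hS.r_continuous
  let X : Fin n → Sig := fun i => Sig.of (fun t => xhat t i - x t i)
    (by have := continuousOn_pi.1 hec i; exact this)
  let E : Fin n → Sig := fun i => Sig.of (fun t => x t i - xref t i) (by fun_prop)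
  let W : Sig := Sig.of (fun t => (θhat t - S.θ) ⬝ᵥ x t)
    (by simp only [dotProduct, Pi.sub_apply]; fun_prop)
  let W₁ : Sig := Sig.of (fun t => θhat t ⬝ᵥ x t + S.kg * S.r t)
    (by simp only [dotProduct]; fun_prop)
  let W₂ : Sig := Sig.of (fun t => S.kg * S.r t + S.θ ⬝ᵥ xref t)
    (by simp only [dotProduct]; fun_prop)
  have hX : ∀ i t, 0 ≤ t → (X i).1 t = xhat t i - x t i := fun i t ht => Sig.of_apply _ ht
  have hE : ∀ i t, 0 ≤ t → (E i).1 t = x t i - xref t i := fun i t ht => Sig.of_apply _ ht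
  have hW : ∀ t, 0 ≤ t → W.1 t = (θhat t - S.θ) ⬝ᵥ x t := fun t ht => Sig.of_apply _ ht
  have hsum : ∀ (c : Fin n → ℝ) t, 0 ≤ t →
      (∑ j, StableSys.const (c j) • E j).1 t = c ⬝ᵥ x t - c ⬝ᵥ xref t := fun c t ht => by
    rw [Sig.sum_apply, ← dotProduct_sub]
    refine Finset.sum_congr rfl fun j _ => ?_
    rw [StableSys.const_smul_apply, hE j t ht, Pi.sub_apply]
  have hu₂ : ∀ t, 0 ≤ t → u₂ t = (hS.Csys • W₁).1 t := fun t ht =>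
    hx.filtered.eq_smul (fun _ => rfl) (fun t ht => Sig.of_apply _ ht) ht
  have huref : ∀ t, 0 ≤ t → uref t + S.K ⬝ᵥ xref t = (hS.Csys • W₂).1 t := fun t ht =>
    hr.control.eq_smul (fun _ => rfl) (fun t ht => Sig.of_apply _ ht) ht
  -- The term k_g r is common to both filter inputs and cancels, leaving θ̂ᵀx - θᵀx_ref = θᵀe + w.
  have hWsub : W₁ - W₂ = ∑ j, StableSys.const (S.θ j) • E j + W := by
    refine Sig.ext_nonneg fun t ht => ?_
    rw [Sig.sub_apply, Sig.add_apply, hsum _ t ht, hW t ht, sub_dotProduct]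
    change (Sig.of _ _).1 t - (Sig.of _ _).1 t = _
    rw [Sig.of_apply _ ht, Sig.of_apply _ ht]
    ring
  have hdiff : ∀ t, 0 ≤ t → u₂ t - (uref t + S.K ⬝ᵥ xref t) =
      (hS.Csys • (∑ j, StableSys.const (S.θ j) • E j + W)).1 t := fun t ht => by
    rw [← hWsub, smul_sub, Sig.sub_apply, hu₂ t ht, huref t ht]
  refine ⟨X, E, W, hX, hE, fun i => ?_, fun i => ?_, fun t ht => ?_⟩
  · rw [show -(hS.Hosys i • W) = hS.Hosys i • (-W) from (smul_neg _ _).symm]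
    refine hS.eq_Hosys_smul (z := fun t => xhat t - x t) ?_ (fun t ht => ?_) hX i
    · simp [hx.predictor_init, hx.plant.1]
    · rw [Sig.neg_apply, hW t ht]
      exact hx.hasDerivWithinAt_error ht
  · refine hS.eq_Hosys_smul (z := fun t => x t - xref t) ?_ (fun t ht => ?_) hE i
    · simp [hr.plant.1, hx.plant.1]
    · refine ((hx.hasDerivWithinAt ht).sub (hr.plant.2 t ht)).congr_deriv ?_
      rw [Sig.sub_apply, hsum _ t ht, ← hdiff t ht, Matrix.mulVec_sub, Am_mulVec (xref t)]
      module
  · rw [Sig.sub_apply, ← hdiff t ht, hsum _ t ht, hx.control t ht]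
    ring

/-- Since H_o w = -x̃, the equation reads e = Ḡη - C x̃ with η = θᵀe. Applying θᵀ yields a scalar
equation (1 - θᵀḠ)η = -Cθᵀx̃, solved by the stable inverse and substituted back. -/
lemma Standing.tracking_error_eq (hS : S.Standing) (hgain : S.GainCondition) {X E : Fin n → Sig}
    {W : Sig} (hX : ∀ i, X i = -(hS.Hosys i • W))
    (hE : ∀ i, E i = hS.Hosys i • (hS.Csys • (∑ j, StableSys.const (S.θ j) • E j + W) -
      ∑ j, StableSys.const (S.θ j) • E j)) (i : Fin n) :
    E i = -∑ j, hS.H2sys hgain i j • X j := by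
  set η := ∑ j, StableSys.const (S.θ j) • E j with hη
  set ξ := ∑ j, StableSys.const (S.θ j) • X j with hξ
  have h1 : ∀ i, E i = hS.Gsys i • η - hS.Csys • X i := fun i => by
    rw [hE i, hX i, Standing.Gsys]
    module
  have h2 : (1 - ∑ j, StableSys.const (S.θ j) * hS.Gsys j) • η = -(hS.Csys • ξ) := by
    rw [StableSys.sub_smul, one_smul, Finset.sum_smul, hξ, Finset.smul_sum]
    nth_rewrite 1 [hη]
    rw [← Finset.sum_sub_distrib, ← Finset.sum_neg_distrib]
    refine Finset.sum_congr rfl fun j _ => ?_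
    rw [h1 j]
    module
  have h3 : η = -((hS.sens hgain * hS.Csys) • ξ) := by
    rw [← one_smul StableSys η, ← hS.sens_mul hgain, mul_smul, h2, smul_neg, mul_smul]
  have h4 : ∑ j, hS.H2sys hgain i j • X j =
      hS.Csys • X i + (hS.Gsys i * hS.sens hgain * hS.Csys) • ξ := by
    simp only [Standing.H2sys, add_smul, Finset.sum_add_distrib, mul_smul _ (StableSys.const _)]
    rw [← Finset.smul_sum]
    congr 1
    simp
  rw [h4, h1 i, h3]
  module

/-- Here q stands for C/(c_oᵀH_o): w is recovered from x̃ by inverting H_o along c_o, and only the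
filtered inverse is required to be a stable proper system. -/
lemma Standing.Csys_smul_eq (hS : S.Standing) {co : Fin n → ℝ} {q : StableSys}
    (hq : q * ∑ i, StableSys.const (co i) * hS.Hosys i = hS.Csys) {X : Fin n → Sig} {W : Sig}
    (hX : ∀ i, X i = -(hS.Hosys i • W)) :
    hS.Csys • W = -∑ i, (q * StableSys.const (co i)) • X i := by
  rw [← hq, Finset.mul_sum, Finset.sum_smul, ← Finset.sum_neg_distrib]
  refine Finset.sum_congr rfl fun i _ => ?_
  rw [hX i]
  module

-- 1/(c_oᵀH_o) has one more zero than poles, which is compensated by strict properness of C; its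
-- poles are zeros of the stable N_n.
open Polynomial in
lemma IsMinPhaseRelDegOne.exists_isImpulseResponse (hS : S.Standing) {co : Fin n → ℝ}
    (hco : S.IsMinPhaseRelDegOne co) :
    ∃ d h, IsImpulseResponse (fun s => S.C s * (1 / S.coHo co s)) d h := by
  obtain ⟨Nn, Nd, hNn, hNd, hdeg, hH⟩ := hco
  have hlt := hS.natDegree_num_lt
  obtain ⟨d, h, H⟩ := exists_isImpulseResponse_div (p := S.filter.num * Nd)
    (hS.filter_stable.mul hNn) (by
      refine natDegree_mul_le.trans ?_
      rw [natDegree_mul hS.filter_stable.ne_zero hNn.ne_zero]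
      omega)
  refine ⟨d, h, H.congr fun s hs => ?_⟩
  rw [hH s hs, C_eq_div, map_mul, map_mul]
  have h1 := hNn.aeval_ne_zero hs
  have h2 := hNd.aeval_ne_zero hs
  have h3 := hS.filter_stable.aeval_ne_zero hs
  field_simp

lemma IsMinPhaseRelDegOne.coHo_ne_zero {co : Fin n → ℝ} (hco : S.IsMinPhaseRelDegOne co) {s : ℂ}
    (hs : 0 ≤ s.re) : S.coHo co s ≠ 0 := by
  obtain ⟨Nn, Nd, hNn, hNd, -, hH⟩ := hco
  rw [hH s hs]
  exact div_ne_zero (hNn.aeval_ne_zero hs) (hNd.aeval_ne_zero hs)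

end Setup

end L1Adaptive

end

/-! ### Assembly of the performance bounds -/

open L1Adaptive in
theorem theorem3 {n : ℕ} (hn : 1 ≤ n) (S : L1Adaptive.Setup n) (hS : S.Standing)
    (hgain : S.GainCondition)
    (x xhat θhat : ℝ → Fin n → ℝ) (u u₂ y : ℝ → ℝ)
    (hx : S.IsClosedLoop x xhat θhat u u₂) (hy : ∀ t, 0 ≤ t → y t = S.c ⬝ᵥ x t)
    (xref : ℝ → Fin n → ℝ) (uref yref : ℝ → ℝ)
    (hxref : S.IsReference xref uref) (hyref : ∀ t, 0 ≤ t → yref t = S.c ⬝ᵥ xref t) :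
    (S.γ₁ < ∞ ∧
      L1Adaptive.linftyNorm (fun t => x t - xref t) ≤ S.γ₁ / ENNReal.ofReal √S.Γc) ∧
    L1Adaptive.linftyNorm (fun t (_ : Unit) => y t - yref t) ≤
      S.cGain * S.γ₁ / ENNReal.ofReal √S.Γc ∧
    (∃ co : Fin n → ℝ, S.IsMinPhaseRelDegOne co) ∧
    ∀ co : Fin n → ℝ, S.IsMinPhaseRelDegOne co →
      S.γ₂ co < ∞ ∧
        L1Adaptive.linftyNorm (fun t (_ : Unit) => u t - uref t) ≤
          S.γ₂ co / ENNReal.ofReal √S.Γc := by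
  obtain ⟨X, E, W, hXv, hEv, hX, hE, hu⟩ := Setup.exists_error_signals hS hx hxref
  have hΓ : 0 < √S.Γc := Real.sqrt_pos.2 hS.Γc_pos
  have hΓ0 : ENNReal.ofReal √S.Γc ≠ 0 := by simpa using hΓ
  have hγ₁ := hS.γ₁_lt_top hgain
  set N : ℝ≥0∞ := ENNReal.ofReal √(S.thetaBarMax / lambdaMin S.P) / ENNReal.ofReal √S.Γc with hN
  have hNtop : N ≠ ∞ := ENNReal.div_ne_top ENNReal.ofReal_ne_top hΓ0
  have hXN : ∀ i t, 0 ≤ t → ENNReal.ofReal |(X i).1 t| ≤ N := fun i t ht => by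
    rw [hXv i t ht, hN, ← ENNReal.ofReal_div_of_pos hΓ]
    exact ENNReal.ofReal_le_ofReal (hx.abs_error_le hn hS ht i)
  have hEN : ∀ i t, 0 ≤ t → ENNReal.ofReal |(E i).1 t| ≤ S.γ₁ / ENNReal.ofReal √S.Γc :=
    fun i t _ => by
      rw [hS.tracking_error_eq hgain hX hE i, Sig.neg_apply, abs_neg, Setup.γ₁, mul_div_assoc]
      exact ofReal_abs_sum_smul_le (H := S.H2) (fun j s => hS.H2sys_apply hgain i j s) hNtop hXN t
  have hγ₁N : S.γ₁ / ENNReal.ofReal √S.Γc ≠ ∞ := ENNReal.div_ne_top hγ₁.ne hΓ0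
  refine ⟨⟨hγ₁, ?_⟩, ?_, S.exists_isMinPhaseRelDegOne hn hS, fun co hco => ?_⟩
  · refine iSup_le fun i => iSup_le fun t => iSup_le fun ht => ?_
    change ENNReal.ofReal |x t i - xref t i| ≤ _
    rw [← hEv i t ht]
    exact hEN i t ht
  · refine iSup_le fun i => iSup_le fun t => iSup_le fun ht => ?_
    have h1 : y t - yref t = (∑ j, StableSys.const (S.c j) • E j).1 t := by
      rw [hy t ht, hyref t ht, Sig.sum_apply, ← dotProduct_sub]
      refine Finset.sum_congr rfl fun j _ => ?_
      rw [StableSys.const_smul_apply, hEv j t ht, Pi.sub_apply]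
    change ENNReal.ofReal |y t - yref t| ≤ _
    rw [h1, mul_div_assoc]
    exact ofReal_abs_sum_smul_le (i := i) (fun j s => rfl) hγ₁N hEN t
  · set q : StableSys := StableSys.mk _ (hco.exists_isImpulseResponse hS)
    have hqC : q * ∑ i, StableSys.const (co i) * hS.Hosys i = hS.Csys := by
      refine Subtype.ext (funext fun s => ?_)
      change S.C s * (1 / S.coHo co s) * (∑ i, StableSys.const (co i) * hS.Hosys i).1 s = S.C s
      have h1 : (∑ i, StableSys.const (co i) * hS.Hosys i).1 s = S.coHo co s := by
        rw [StableSys.sum_apply]; rfl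
      rw [h1, mul_assoc, one_div, inv_mul_cancel₀ (hco.coHo_ne_zero s.2), mul_one]
    set F₁ : Fin n → StableSys := fun i => q * StableSys.const (co i) with hF₁
    set F₂ : Fin n → StableSys := fun i =>
      hS.Csys * StableSys.const (S.θ i) - StableSys.const (S.K i) with hF₂
    refine ⟨ENNReal.add_lt_top.2 ⟨ENNReal.mul_lt_top (l1Gain_lt_top fun _ j =>
      (F₁ j).exists_impulse_of_eq fun s => rfl) ENNReal.ofReal_lt_top,
      ENNReal.mul_lt_top (l1Gain_lt_top fun _ j =>
        (F₂ j).exists_impulse_of_eq fun s => rfl) hγ₁⟩, ?_⟩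
    refine iSup_le fun i => iSup_le fun t => iSup_le fun ht => ?_
    -- Splitting u - u_ref into C w, rewritten through x̃, and (Cθᵀ - Kᵀ)e matches the two summands
    -- of γ₂.
    have h1 : u t - uref t = -(∑ j, F₁ j • X j).1 t + (∑ j, F₂ j • E j).1 t := by
      rw [hu t ht, ← Sig.neg_apply, ← hS.Csys_smul_eq hqC hX, ← Sig.add_apply]
      have h2 : ∑ j, F₂ j • E j = hS.Csys • ∑ j, StableSys.const (S.θ j) • E j -
          ∑ j, StableSys.const (S.K j) • E j := by
        rw [Finset.smul_sum, ← Finset.sum_sub_distrib]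
        refine Finset.sum_congr rfl fun j _ => ?_
        simp only [hF₂]
        rw [StableSys.sub_smul, mul_smul]
      rw [h2, smul_add]
      simp only [Sig.add_apply, Sig.sub_apply]
      ring
    change ENNReal.ofReal |u t - uref t| ≤ _
    rw [h1, Setup.γ₂, ENNReal.add_div, mul_div_assoc, mul_div_assoc]
    refine (ENNReal.ofReal_le_ofReal (abs_add_le _ _)).trans ?_
    rw [ENNReal.ofReal_add (abs_nonneg _) (abs_nonneg _), abs_neg]
    exact add_le_add (ofReal_abs_sum_smul_le (i := i) (fun j s => rfl) hNtop hXN t)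
      (ofReal_abs_sum_smul_le (i := i) (fun j s => rfl) hγ₁N hEN t)
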